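/- **Setting.** Let $\phi:\mathcal A\to\mathbb R^d$ be a measurable feature map, $\Theta\subset\mathbb R^d$, and $f_\rho(a)=\langle\phi(a),\rho\rangle$ for $\rho\in\Theta$, $a\in\mathcal A$. On a probability space, let $\theta$ be a $\Theta$-valued random variable. In each round $t=1,2,\dots$ a random set $\mathcal A_t\subseteq\mathcal A$ of actions is presented, an action $A_t\in\mathcal A_t$ is chosen, and a real reward $R_t$ is observed. Let $H_t=(\mathcal A_1,A_1,R_1,\dots,\mathcal A_{t-1},A_{t-1},R_{t-1},\mathcal A_t)$. The actions are chosen by posterior sampling: there are random variables $A_t^*\in\arg\max_{a\in\mathcal A_t}f_\theta(a)$ (almost surely) with $\mathbb P(A_t\in\cdot\mid H_t)=\mathbb P(A_t^*\in\cdot\mid H_t)$ for every $t$. The Bayesian regret is $$\mathrm{BayesRegret}(T)=\sum_{t=1}^T\mathbb E\Big[\max_{a\in\mathcal A_t}f_\theta(a)-f_\theta(A_t)\Big],$$ and $\|\theta\|_0$ denotes the number of nonzero components of $\theta$. Let $\sigma,c_1,c_2>0$, and assume that $\sup_{\rho\in\Theta}\|\rho\|_2\le c_1$, that $\sup_{a\in\mathcal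 A}\|\phi(a)\|_2\le c_2$, and that for every $t$ the noise $R_t-f_\theta(A_t)$ is $\sigma$-sub-Gaussian conditionally on $(H_t,A_t,\theta)$, that is, $\mathbb E[e^{\lambda(R_t-f_\theta(A_t))}\mid H_t,A_t,\theta]\le e^{\lambda^2\sigma^2/2}$ almost surely for every $\lambda\in\mathbb R$. **Proposition.** There are a universal $k\in\mathbb N$ and a constant $C>0$ that depends only on $\sigma,c_1,c_2$ such that, for every $d$ and every problem as above: 1. $\mathrm{BayesRegret}(T)\le C\,d\,\log T\,\sqrt T$ for all $T\ge2$. 2. $\mathrm{BayesRegret}(T)=\tilde O\big(\mathbb E\sqrt{\|\theta\|_0\,d\,T}\big)$ as $T\to\infty$: one has $\mathrm{BayesRegret}(T)\le C(\log T)^k\,\mathbb E\sqrt{\|\theta\|_0\,d\,T}$ for all sufficiently large $T$ (how large may depend on the problem). Moreover, the bound holds for all $T\ge 2$ with a constant that depends on the prior only through the ratio of $\sqrt{\mathbb E\|\theta\|_0}$ to $\mathbb E\sqrt{\|\theta\|_0}$: if $\kappa\in\mathbb R$ satisfies $\sqrt{\mathbb E\|\theta\|_0}\le\kappa\,\mathbb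 E\sqrt{\|\theta\|_0}$ (for example $\kappa=1$ when $\|\theta\|_0$ is deterministic), then $$\mathrm{BayesRegret}(T)\le C\,\kappa\,(\log T)^k\,\mathbb E\sqrt{\|\theta\|_0\,d\,T}\qquad\text{for all }T\ge2 .$$ -/

import Mathlib

open MeasureTheory

noncomputable section

/-- A run of a bandit problem on the probability space `(Ω, μ)`, with parameters in `P` and actions
in `𝒜`.  Rounds are numbered `0, 1, 2, …`, so the first `T` rounds are those with `t < T`.
`setSigma` is the σ-algebra on the collection of subsets of `𝒜` for which the random action sets
are random variables; it is arbitrary. -/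
structure BanditProcess {Ω : Type*} [MeasurableSpace Ω] (μ : Measure Ω)
    (P : Type*) [MeasurableSpace P] (𝒜 : Type*) [MeasurableSpace 𝒜] where
  setSigma : MeasurableSpace (Set 𝒜)
  /-- the random index of the true reward function -/
  param : Ω → P
  /-- the random set of actions available in round `t` -/
  actionSet : ℕ → Ω → Set 𝒜
  /-- the action chosen in round `t` -/
  action : ℕ → Ω → 𝒜
  /-- the reward observed in round `t` -/
  reward : ℕ → Ω → ℝ
  measurable_param : Measurable param
  measurable_actionSet : ∀ t, Measurable[_, setSigma] (actionSet t)
  measurable_action : ∀ t, Measurable (action t)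
  measurable_reward : ∀ t, Measurable (reward t)
  action_mem : ∀ t, ∀ᵐ ω ∂μ, action t ω ∈ actionSet t ω

namespace BanditProcess

variable {Ω : Type*} [mΩ : MeasurableSpace Ω] {μ : Measure Ω}
  {P : Type*} [mP : MeasurableSpace P] {𝒜 : Type*} [m𝒜 : MeasurableSpace 𝒜]

/-- The σ-algebra generated by the history available when the action of round `t` is chosen: the
action sets of the rounds `k ≤ t`, and the actions and rewards of the rounds `k < t`. -/
def history (X : BanditProcess μ P 𝒜) (t : ℕ) : MeasurableSpace Ω :=
  (⨆ k, ⨆ _ : k ≤ t, MeasurableSpace.comap (X.actionSet k) X.setSigma) ⊔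
    ⨆ k, ⨆ _ : k < t,
      (MeasurableSpace.comap (X.action k) m𝒜 ⊔ MeasurableSpace.comap (X.reward k) inferInstance)

/-- The σ-algebra generated by the history, the action chosen in round `t`, and the parameter. -/
def historyActionParam (X : BanditProcess μ P 𝒜) (t : ℕ) : MeasurableSpace Ω :=
  X.history t ⊔ MeasurableSpace.comap (X.action t) m𝒜 ⊔ MeasurableSpace.comap X.param mP

theorem history_le (X : BanditProcess μ P 𝒜) (t : ℕ) : X.history t ≤ mΩ :=
  sup_le (iSup₂_le fun k _ => (X.measurable_actionSet k).comap_le)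
    (iSup₂_le fun k _ => sup_le (X.measurable_action k).comap_le (X.measurable_reward k).comap_le)

theorem historyActionParam_le (X : BanditProcess μ P 𝒜) (t : ℕ) :
    X.historyActionParam t ≤ mΩ :=
  sup_le (sup_le (X.history_le t) (X.measurable_action t).comap_le) X.measurable_param.comap_le

/-- `a` is an available action that maximizes the true reward function in round `t`. -/
def IsOptimalAction (X : BanditProcess μ P 𝒜) (f : P → 𝒜 → ℝ) (t : ℕ) (ω : Ω) (a : 𝒜) : Prop :=
  a ∈ X.actionSet t ω ∧ ∀ b ∈ X.actionSet t ω, f (X.param ω) b ≤ f (X.param ω) a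

/-- The actions are chosen by posterior sampling: conditionally on the history, the action of
round `t` has the distribution of an optimal action `Astar t`. -/
def IsPosteriorSampling (X : BanditProcess μ P 𝒜) (f : P → 𝒜 → ℝ) : Prop :=
  ∃ Astar : ℕ → Ω → 𝒜,
    (∀ t, Measurable (Astar t)) ∧
    (∀ t, ∀ᵐ ω ∂μ, X.IsOptimalAction f t ω (Astar t ω)) ∧
    ∀ t, ∀ B : Set 𝒜, MeasurableSet B →
      μ[((X.action t) ⁻¹' B).indicator (fun _ => (1 : ℝ)) | X.history t] =ᵐ[μ]
        μ[((Astar t) ⁻¹' B).indicator (fun _ => (1 : ℝ)) | X.history t]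

/-- The Bayesian regret of the first `T` rounds.  The supremum is a maximum wherever an optimal
action exists. -/
def bayesRegret (X : BanditProcess μ P 𝒜) (f : P → 𝒜 → ℝ) (T : ℕ) : ℝ :=
  ∑ t ∈ Finset.range T,
    ∫ ω, (sSup (f (X.param ω) '' X.actionSet t ω) - f (X.param ω) (X.action t ω)) ∂μ

end BanditProcess

/-- `Y` is `σ`-sub-Gaussian conditionally on the σ-algebra `m`. -/
def IsCondSubGaussian {Ω : Type*} [MeasurableSpace Ω] (μ : Measure Ω) (m : MeasurableSpace Ω)
    (Y : Ω → ℝ) (σ : ℝ) : Prop :=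
  ∀ l : ℝ, Integrable (fun ω => Real.exp (l * Y ω)) μ ∧
    ∀ᵐ ω ∂μ, (μ[fun ω' => Real.exp (l * Y ω') | m]) ω ≤ Real.exp (l ^ 2 * σ ^ 2 / 2)

/-- The linear reward functions with feature map `φ`. -/
def linearReward {d : ℕ} {𝒜 : Type*} (φ : 𝒜 → EuclideanSpace ℝ (Fin d))
    (ρ : EuclideanSpace ℝ (Fin d)) (a : 𝒜) : ℝ :=
  inner ℝ (φ a) ρ

/-- The number of nonzero components. -/
def zeroNorm {d : ℕ} (v : EuclideanSpace ℝ (Fin d)) : ℕ := {i : Fin d | v i ≠ 0}.ncard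

/-- A linear bandit problem with parameter set `Θ` and feature map `φ`, bounded by `c₁` and `c₂`,
with conditionally `σ`-sub-Gaussian noise (which makes the noise conditionally centred), whose
actions are chosen by posterior sampling. -/
structure IsLinearPosteriorSampling {d : ℕ} {Ω : Type*} [MeasurableSpace Ω] {μ : Measure Ω}
    {𝒜 : Type*} [MeasurableSpace 𝒜] (σ c₁ c₂ : ℝ) (Θ : Set (EuclideanSpace ℝ (Fin d)))
    (φ : 𝒜 → EuclideanSpace ℝ (Fin d))
    (X : BanditProcess μ (EuclideanSpace ℝ (Fin d)) 𝒜) : Prop where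
  measurable_feature : Measurable φ
  norm_param_le : ∀ ρ ∈ Θ, ‖ρ‖ ≤ c₁
  norm_feature_le : ∀ a, ‖φ a‖ ≤ c₂
  param_mem : ∀ᵐ ω ∂μ, X.param ω ∈ Θ
  noise : ∀ t, IsCondSubGaussian μ (X.historyActionParam t)
    (fun ω => X.reward t ω - linearReward φ (X.param ω) (X.action t ω)) σ
  posteriorSampling : X.IsPosteriorSampling (linearReward φ)

end

/-! ### Conditionally sub-Gaussian variables -/

section CondSubGaussian

variable {Ω : Type*} {m mΩ : MeasurableSpace Ω} {μ : Measure Ω} {Y : Ω → ℝ} {σ : ℝ}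

/-! Write S = E‖θ‖₀. Everything follows from one bound, regret ≤ C log T √(S d T), proved in
`IsLinearPosteriorSampling.exists_bayesRegret_le`; the method is an online-to-confidence-set
conversion used only in the analysis.

Prediction. Run the exponentially weighted forecaster for the squared loss on the rewards, with a
finite grid of parameter vectors as experts and a prior that favours sparse vectors. The experts
close to θ have prior mass about T^(-c‖θ‖₀), so the expected cumulative squared error of the
predictions y_k of the mean rewards is of order S log T (`integral_sum_sq_sub_expForecast_le`,
`IsLinearPosteriorSampling.exists_prediction`). The predictions depend on the history alone.

Estimation. Fit ridge regression to the y_k instead of the rewards. With V the regularized Gram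
matrix and ρ the estimate, ‖θ - ρ‖²_V is at most r‖θ‖² plus the squared prediction error, for every
θ and without any probability (`ridge_error_le`).

Exchange. Given the history, the played and the optimal action have the same law, and V and ρ are
functions of the history. Hence E⟨φ(A), ρ⟩ = E⟨φ(A*), ρ⟩, and the widths φ(A)ᵀV⁻¹φ(A) have equal
means. The regret of a round becomes E⟨φ(A*), θ - ρ⟩ - E⟨φ(A), θ - ρ⟩, and Young's inequality bounds
it by α times the mean width plus α⁻¹ times the mean estimation error
(`IsLinearPosteriorSampling.integral_regret_le`).

Summation. The widths sum to at most 2 d log(d + T) by the elliptical potential lemma, and α = √(S T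
/ d) balances the two terms.

Since S ≤ d, this gives the first claim. For the others, √S has to be compared with E√‖θ‖₀: the
ratio is at most κ by assumption, or is eventually dominated by one more factor log T. -/

theorem Real.exp_mul_le_exp_add_exp_neg {l L : ℝ} (hl : |l| ≤ L) (y : ℝ) :
    Real.exp (l * y) ≤ Real.exp (L * y) + Real.exp (-L * y) := by
  obtain ⟨h₁, h₂⟩ := abs_le.1 hl
  rcases le_total 0 y with hy | hy
  · have : Real.exp (l * y) ≤ Real.exp (L * y) := Real.exp_le_exp.2 (by nlinarith)
    linarith [Real.exp_pos (-L * y)]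
  · have : Real.exp (l * y) ≤ Real.exp (-L * y) := Real.exp_le_exp.2 (by nlinarith)
    linarith [Real.exp_pos (L * y)]

theorem IsCondSubGaussian.congr {Y' : Ω → ℝ} (hY : IsCondSubGaussian μ m Y σ) (h : Y =ᵐ[μ] Y') :
    IsCondSubGaussian μ m Y' σ := by
  intro l
  have he : (fun ω => Real.exp (l * Y ω)) =ᵐ[μ] fun ω => Real.exp (l * Y' ω) := by
    filter_upwards [h] with ω hω
    rw [hω]
  refine ⟨(hY l).1.congr he, ?_⟩
  filter_upwards [(hY l).2, condExp_congr_ae (m := m) he] with ω h₁ h₂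
  rwa [← h₂]

theorem IsCondSubGaussian.integrable_mul_exp (hY : IsCondSubGaussian μ m Y σ) (hYm : Measurable Y)
    {h l : Ω → ℝ} (hh : Measurable h) (hl : Measurable l) {K L : ℝ}
    (hK : ∀ ω, |h ω| ≤ K) (hL : ∀ ω, |l ω| ≤ L) :
    Integrable (fun ω => h ω * Real.exp (l ω * Y ω)) μ := by
  refine (((hY L).1.add (hY (-L)).1).const_mul K).mono'
    (by fun_prop) (Filter.Eventually.of_forall fun ω => ?_)
  rw [norm_mul, Real.norm_eq_abs, Real.norm_eq_abs, Real.abs_exp]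
  exact mul_le_mul (hK ω) (Real.exp_mul_le_exp_add_exp_neg (hL ω) _) (Real.exp_pos _).le
    ((abs_nonneg _).trans (hK ω))

/-- The `m`-measurable weight is pulled out of the conditional expectation. -/
theorem IsCondSubGaussian.integral_mul_exp_const_le [IsFiniteMeasure μ] (hm : m ≤ mΩ)
    (hY : IsCondSubGaussian μ m Y σ) (hYm : Measurable Y)
    {h : Ω → ℝ} (hh : Measurable[m] h) {K : ℝ} (h0 : ∀ ω, 0 ≤ h ω) (hK : ∀ ω, h ω ≤ K) (l : ℝ) :
    ∫ ω, h ω * Real.exp (l * Y ω) ∂μ ≤ ∫ ω, h ω * Real.exp (l ^ 2 * σ ^ 2 / 2) ∂μ := by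
  have hK' : ∀ ω, |h ω| ≤ K := fun ω => by rw [abs_of_nonneg (h0 ω)]; exact hK ω
  have hi : Integrable (fun ω => h ω * Real.exp (l * Y ω)) μ :=
    hY.integrable_mul_exp hYm (hh.mono hm le_rfl) measurable_const hK' (fun _ => le_rfl)
  rw [← integral_condExp hm]
  have hpull := condExp_mul_of_stronglyMeasurable_left (μ := μ) hh.stronglyMeasurable hi (hY l).1
  refine integral_mono_ae integrable_condExp ?_ ?_
  · exact (Integrable.of_bound (hh.mono hm le_rfl).aestronglyMeasurable K
      (Filter.Eventually.of_forall hK')).mul_const _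
  · filter_upwards [hpull, (hY l).2] with ω h₁ h₂
    rw [show (fun ω => h ω * Real.exp (l * Y ω)) = h * fun ω => Real.exp (l * Y ω) from rfl, h₁]
    exact mul_le_mul_of_nonneg_left h₂ (h0 ω)

/-- On each level set of `l` the exponent is constant, so multiplying the weight by the indicator of
the level set reduces to the case of a constant. -/
theorem IsCondSubGaussian.integral_mul_exp_simpleFunc_le [IsFiniteMeasure μ] (hm : m ≤ mΩ)
    (hY : IsCondSubGaussian μ m Y σ) (hYm : Measurable Y)
    {h : Ω → ℝ} (hh : Measurable[m] h) {K : ℝ} (h0 : ∀ ω, 0 ≤ h ω) (hK : ∀ ω, h ω ≤ K)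
    (l : @SimpleFunc Ω m ℝ) :
    ∫ ω, h ω * Real.exp (l ω * Y ω) ∂μ ≤ ∫ ω, h ω * Real.exp (l ω ^ 2 * σ ^ 2 / 2) ∂μ := by
  have hset : ∀ v, MeasurableSet[m] (l ⁻¹' {v}) := fun v =>
    @SimpleFunc.measurableSet_fiber _ _ m l v
  have hind : ∀ F : ℝ → Ω → ℝ, ∀ ω,
      h ω * F (l ω) ω = ∑ v ∈ @SimpleFunc.range _ _ m l, (l ⁻¹' {v}).indicator h ω * F v ω := by
    intro F ω
    rw [Finset.sum_eq_single (l ω)]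
    · rw [Set.indicator_of_mem (by simp)]
    · intro v _ hv
      rw [Set.indicator_of_notMem (by simpa using hv.symm), zero_mul]
    · intro hn
      exact absurd (@SimpleFunc.mem_range_self _ _ m l ω) hn
  have hm' : ∀ v, Measurable[m] ((l ⁻¹' {v}).indicator h) := fun v => hh.indicator (hset v)
  have h0' : ∀ v ω, 0 ≤ (l ⁻¹' {v}).indicator h ω := fun v ω =>
    Set.indicator_nonneg (fun ω _ => h0 ω) ω
  have hK' : ∀ v ω, (l ⁻¹' {v}).indicator h ω ≤ K := fun v ω =>
    (Set.indicator_le_self' (fun ω _ => h0 ω) ω).trans (hK ω)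
  have hKabs : ∀ v ω, |(l ⁻¹' {v}).indicator h ω| ≤ K := fun v ω => by
    rw [abs_of_nonneg (h0' v ω)]; exact hK' v ω
  simp_rw [hind (fun v ω => Real.exp (v * Y ω)), hind (fun v _ => Real.exp (v ^ 2 * σ ^ 2 / 2))]
  rw [integral_finsetSum, integral_finsetSum]
  · exact Finset.sum_le_sum fun v _ =>
      hY.integral_mul_exp_const_le hm hYm (hm' v) (h0' v) (hK' v) v
  · exact fun v _ => (Integrable.of_bound ((hm' v).mono hm le_rfl).aestronglyMeasurable K
      (Filter.Eventually.of_forall (hKabs v))).mul_const _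
  · exact fun v _ => hY.integrable_mul_exp hYm ((hm' v).mono hm le_rfl) measurable_const
      (hKabs v) (fun _ => le_rfl)

/-- The conditional sub-Gaussian bound with a bounded random parameter `l` and weight `h`. -/
theorem IsCondSubGaussian.integral_mul_exp_le [IsFiniteMeasure μ] (hm : m ≤ mΩ)
    (hY : IsCondSubGaussian μ m Y σ) (hYm : Measurable Y)
    {h l : Ω → ℝ} (hh : Measurable[m] h) (hl : Measurable[m] l) {K L : ℝ}
    (h0 : ∀ ω, 0 ≤ h ω) (hK : ∀ ω, h ω ≤ K) (hL : ∀ ω, |l ω| ≤ L) :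
    ∫ ω, h ω * Real.exp (l ω * Y ω) ∂μ ≤ ∫ ω, h ω * Real.exp (l ω ^ 2 * σ ^ 2 / 2) ∂μ := by
  have hK' : ∀ ω, |h ω| ≤ K := fun ω => by rw [abs_of_nonneg (h0 ω)]; exact hK ω
  have hls : StronglyMeasurable[m] l := hl.stronglyMeasurable
  -- Approximants keep the bound `L`, so `K * (exp (L * Y) + exp (-L * Y))` dominates the integrands
  -- on the left.
  set s : ℕ → @SimpleFunc Ω m ℝ := hls.approxBounded L with hs
  have hsL : ∀ n ω, |s n ω| ≤ L := fun n ω =>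
    hls.norm_approxBounded_le ((abs_nonneg _).trans (hL ω)) n ω
  have hst : ∀ ω, Filter.Tendsto (fun n => s n ω) Filter.atTop (nhds (l ω)) := fun ω =>
    hls.tendsto_approxBounded_of_norm_le (hL ω)
  have hsm : ∀ n, Measurable (s n) := fun n => (@SimpleFunc.measurable _ _ m _ (s n)).mono hm le_rfl
  have hhm : Measurable h := hh.mono hm le_rfl
  have h1 : Filter.Tendsto (fun n => ∫ ω, h ω * Real.exp (s n ω * Y ω) ∂μ) Filter.atTop
      (nhds (∫ ω, h ω * Real.exp (l ω * Y ω) ∂μ)) := by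
    refine tendsto_integral_of_dominated_convergence _ (fun n => ?_)
      (((hY L).1.add (hY (-L)).1).const_mul K) (fun n => Filter.Eventually.of_forall fun ω => ?_)
      (Filter.Eventually.of_forall fun ω => ?_)
    · have := hsm n
      fun_prop
    · rw [norm_mul, Real.norm_eq_abs, Real.norm_eq_abs, Real.abs_exp]
      exact mul_le_mul (hK' ω) (Real.exp_mul_le_exp_add_exp_neg (hsL n ω) _) (Real.exp_pos _).le
        ((abs_nonneg _).trans (hK' ω))
    · exact ((Real.continuous_exp.tendsto _).comp ((hst ω).mul_const _)).const_mul _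
  have h2 : Filter.Tendsto (fun n => ∫ ω, h ω * Real.exp (s n ω ^ 2 * σ ^ 2 / 2) ∂μ) Filter.atTop
      (nhds (∫ ω, h ω * Real.exp (l ω ^ 2 * σ ^ 2 / 2) ∂μ)) := by
    refine tendsto_integral_of_dominated_convergence (fun _ => K * Real.exp (L ^ 2 * σ ^ 2 / 2))
      (fun n => ?_) (integrable_const _) (fun n => Filter.Eventually.of_forall fun ω => ?_)
      (Filter.Eventually.of_forall fun ω => ?_)
    · have := hsm n
      fun_prop
    · rw [norm_mul, Real.norm_eq_abs, Real.norm_eq_abs, Real.abs_exp]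
      have hsq : s n ω ^ 2 ≤ L ^ 2 := sq_le_sq.2 ((hsL n ω).trans (le_abs_self L))
      exact mul_le_mul (hK' ω) (by gcongr) (Real.exp_pos _).le ((abs_nonneg _).trans (hK' ω))
    · exact ((Real.continuous_exp.tendsto _).comp
        ((((hst ω).pow 2).mul_const _).div_const _)).const_mul _
  exact le_of_tendsto_of_tendsto' h1 h2 fun n =>
    hY.integral_mul_exp_simpleFunc_le hm hYm hh h0 hK (s n)

theorem IsCondSubGaussian.integrable_mul (hY : IsCondSubGaussian μ m Y σ) (hYm : Measurable Y)
    {h : Ω → ℝ} (hh : Measurable h) {K : ℝ} (hK : ∀ ω, |h ω| ≤ K) :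
    Integrable (fun ω => h ω * Y ω) μ := by
  refine (((hY 1).1.add (hY (-1)).1).const_mul K).mono'
    (by fun_prop) (Filter.Eventually.of_forall fun ω => ?_)
  rw [norm_mul, Real.norm_eq_abs, Real.norm_eq_abs]
  refine mul_le_mul (hK ω) ?_ (abs_nonneg _) ((abs_nonneg _).trans (hK ω))
  simp only [Pi.add_apply]
  have h₁ := Real.add_one_le_exp (1 * Y ω)
  have h₂ := Real.add_one_le_exp (-1 * Y ω)
  have h₃ := Real.exp_pos (1 * Y ω)
  have h₄ := Real.exp_pos (-1 * Y ω)
  exact abs_le.2 ⟨by linarith, by linarith⟩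

/-- Sub-Gaussian noise is centred: with a the integral, 1 + s a ≤ exp(O(s²)) for all real s, with
equality at s = 0, so the derivatives there agree and a = 0. -/
theorem IsCondSubGaussian.integral_mul_eq_zero [IsProbabilityMeasure μ] (hm : m ≤ mΩ)
    (hY : IsCondSubGaussian μ m Y σ) (hYm : Measurable Y)
    {h : Ω → ℝ} (hh : Measurable[m] h) {K : ℝ} (hK : ∀ ω, |h ω| ≤ K) :
    ∫ ω, h ω * Y ω ∂μ = 0 := by
  have hhm : Measurable h := hh.mono hm le_rfl
  set a := ∫ ω, h ω * Y ω ∂μ with ha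
  have key : ∀ s : ℝ, 1 + s * a ≤ Real.exp (s ^ 2 * (K ^ 2 * σ ^ 2 / 2)) := by
    intro s
    have hsK : ∀ ω, |s * h ω| ≤ |s| * K := fun ω => by
      rw [abs_mul]; exact mul_le_mul_of_nonneg_left (hK ω) (abs_nonneg s)
    have h1 : ∫ ω, (1 + s * (h ω * Y ω)) ∂μ ≤ ∫ ω, 1 * Real.exp ((s * h ω) * Y ω) ∂μ := by
      refine integral_mono ((integrable_const _).add ((hY.integrable_mul hYm hhm hK).const_mul s))
        (hY.integrable_mul_exp hYm measurable_const (by fun_prop) (K := 1) (by simp) hsK) ?_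
      intro ω
      have := Real.add_one_le_exp (s * h ω * Y ω)
      dsimp only
      linarith
    have h2 := hY.integral_mul_exp_le hm hYm (h := fun _ => 1) (l := fun ω => s * h ω)
      measurable_const (hh.const_mul s) (K := 1) (by simp) (by simp) hsK
    have h3 : ∫ ω, 1 * Real.exp ((s * h ω) ^ 2 * σ ^ 2 / 2) ∂μ ≤
        ∫ _, Real.exp (s ^ 2 * (K ^ 2 * σ ^ 2 / 2)) ∂μ := by
      have hb : ∀ ω, Real.exp ((s * h ω) ^ 2 * σ ^ 2 / 2) ≤
          Real.exp (s ^ 2 * (K ^ 2 * σ ^ 2 / 2)) := by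
        intro ω
        have : h ω ^ 2 ≤ K ^ 2 := sq_le_sq.2 ((hK ω).trans (le_abs_self K))
        rw [show (s * h ω) ^ 2 * σ ^ 2 / 2 = s ^ 2 * (h ω ^ 2 * σ ^ 2 / 2) by ring]
        gcongr
      simp only [one_mul]
      refine integral_mono (Integrable.of_bound (by fun_prop)
        (Real.exp (s ^ 2 * (K ^ 2 * σ ^ 2 / 2))) (Filter.Eventually.of_forall fun ω => ?_))
        (integrable_const _) hb
      rw [Real.norm_eq_abs, Real.abs_exp]
      exact hb ω
    rw [integral_add (integrable_const _) ((hY.integrable_mul hYm hhm hK).const_mul s),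
      integral_const_mul] at h1
    simp only [integral_const, probReal_univ, smul_eq_mul, one_mul] at h1 h2 h3
    linarith
  have hd : HasDerivAt (fun s : ℝ => 1 + s * a - Real.exp (s ^ 2 * (K ^ 2 * σ ^ 2 / 2))) a 0 := by
    have := (((hasDerivAt_id (0 : ℝ)).mul_const a).const_add 1).sub
      (((hasDerivAt_pow 2 (0 : ℝ)).mul_const (K ^ 2 * σ ^ 2 / 2)).exp)
    convert! this using 1
    simp
  refine IsLocalMax.hasDerivAt_eq_zero (Filter.Eventually.of_forall fun s => ?_) hd
  have := key s
  simp
  linarith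

end CondSubGaussian

/-! ### Ridge regression and the elliptical potential -/

section Matrices

open Matrix

variable {d : ℕ}

/-- The regularized Gram matrix of the first `n` vectors of a sequence. -/
noncomputable def regGram (r : ℝ) (v : ℕ → Fin d → ℝ) (n : ℕ) : Matrix (Fin d) (Fin d) ℝ :=
  r • (1 : Matrix (Fin d) (Fin d) ℝ) + ∑ k ∈ Finset.range n, vecMulVec (v k) (v k)

/-- The ridge regression estimate for the responses `y`. -/
noncomputable def ridge (r : ℝ) (v : ℕ → Fin d → ℝ) (y : ℕ → ℝ) (n : ℕ) : Fin d → ℝ :=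
  (regGram r v n)⁻¹ *ᵥ ∑ k ∈ Finset.range n, y k • v k

theorem regGram_mulVec (r : ℝ) (v : ℕ → Fin d → ℝ) (n : ℕ) (x : Fin d → ℝ) :
    regGram r v n *ᵥ x = r • x + ∑ k ∈ Finset.range n, (v k ⬝ᵥ x) • v k := by
  rw [regGram, add_mulVec, smul_mulVec, one_mulVec, Matrix.sum_mulVec]
  congr 1
  refine Finset.sum_congr rfl fun k _ => ?_
  rw [vecMulVec_mulVec]
  ext i
  simp [mul_comm]

theorem dotProduct_regGram_mulVec (r : ℝ) (v : ℕ → Fin d → ℝ) (n : ℕ) (x : Fin d → ℝ) :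
    x ⬝ᵥ regGram r v n *ᵥ x = r * (x ⬝ᵥ x) + ∑ k ∈ Finset.range n, (v k ⬝ᵥ x) ^ 2 := by
  rw [regGram_mulVec, dotProduct_add, dotProduct_smul, dotProduct_sum, smul_eq_mul]
  congr 1
  refine Finset.sum_congr rfl fun k _ => ?_
  rw [dotProduct_smul, dotProduct_comm x, smul_eq_mul, sq]

theorem isHermitian_regGram (r : ℝ) (v : ℕ → Fin d → ℝ) (n : ℕ) : (regGram r v n).IsHermitian := by
  rw [IsHermitian, conjTranspose_eq_transpose_of_trivial, regGram, transpose_add, transpose_smul,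
    transpose_one, transpose_sum]
  simp [transpose_vecMulVec]

theorem dotProduct_self_nonneg' (x : Fin d → ℝ) : 0 ≤ x ⬝ᵥ x :=
  Finset.sum_nonneg fun i _ => mul_self_nonneg (x i)

theorem posDef_regGram {r : ℝ} (hr : 0 < r) (v : ℕ → Fin d → ℝ) (n : ℕ) :
    (regGram r v n).PosDef := by
  refine PosDef.of_dotProduct_mulVec_pos (isHermitian_regGram r v n) fun x hx => ?_
  rw [star_trivial, dotProduct_regGram_mulVec]
  have h : 0 < x ⬝ᵥ x :=
    (dotProduct_self_nonneg' x).lt_of_ne fun h => hx (dotProduct_self_eq_zero.1 h.symm)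
  have := Finset.sum_nonneg fun k (_ : k ∈ Finset.range n) => sq_nonneg (v k ⬝ᵥ x)
  positivity

theorem regGram_mulVec_inv_mulVec {r : ℝ} (hr : 0 < r) (v : ℕ → Fin d → ℝ) (n : ℕ)
    (u : Fin d → ℝ) : regGram r v n *ᵥ ((regGram r v n)⁻¹ *ᵥ u) = u := by
  rw [mulVec_mulVec, mul_nonsing_inv _ (posDef_regGram hr v n).det_pos.ne'.isUnit, one_mulVec]

theorem dotProduct_inv_regGram_mulVec_nonneg {r : ℝ} (hr : 0 < r) (v : ℕ → Fin d → ℝ) (n : ℕ)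
    (u : Fin d → ℝ) : 0 ≤ u ⬝ᵥ (regGram r v n)⁻¹ *ᵥ u := by
  have h := (posDef_regGram hr v n).inv.posSemidef.dotProduct_mulVec_nonneg u
  rwa [star_trivial] at h

theorem dotProduct_regGram_comm (r : ℝ) (v : ℕ → Fin d → ℝ) (n : ℕ) (x y : Fin d → ℝ) :
    x ⬝ᵥ regGram r v n *ᵥ y = y ⬝ᵥ regGram r v n *ᵥ x := by
  have h : (regGram r v n)ᵀ = regGram r v n := by
    rw [← conjTranspose_eq_transpose_of_trivial]
    exact isHermitian_regGram r v n
  rw [dotProduct_mulVec, ← mulVec_transpose, h, dotProduct_comm]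

/-- Young's inequality for the dual norms of the regularized Gram matrix. -/
theorem two_mul_dotProduct_le_regGram {r : ℝ} (hr : 0 < r) (v : ℕ → Fin d → ℝ) (n : ℕ)
    (u x : Fin d → ℝ) {α : ℝ} (hα : 0 < α) :
    2 * (u ⬝ᵥ x) ≤
      α * (u ⬝ᵥ (regGram r v n)⁻¹ *ᵥ u) + α⁻¹ * (x ⬝ᵥ regGram r v n *ᵥ x) := by
  set z := (regGram r v n)⁻¹ *ᵥ u with hz
  have hzu : regGram r v n *ᵥ z = u := regGram_mulVec_inv_mulVec hr v n u
  -- Expanding the quadratic form at `α • z - x`, where z = V⁻¹u, and dividing by `α` gives the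
  -- claim.
  have h := (posDef_regGram hr v n).posSemidef.dotProduct_mulVec_nonneg (α • z - x)
  rw [star_trivial, mulVec_sub, mulVec_smul, hzu, sub_dotProduct, dotProduct_sub, dotProduct_sub,
    smul_dotProduct, smul_dotProduct, dotProduct_smul, dotProduct_smul,
    dotProduct_regGram_comm r v n z x, hzu, dotProduct_comm z u, dotProduct_comm x u] at h
  simp only [smul_eq_mul] at h
  have h' : α⁻¹ * (α * (α * (u ⬝ᵥ z)) - α * (u ⬝ᵥ x) - (α * (u ⬝ᵥ x) - x ⬝ᵥ regGram r v n *ᵥ x)) =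
      α * (u ⬝ᵥ z) + α⁻¹ * (x ⬝ᵥ regGram r v n *ᵥ x) - 2 * (u ⬝ᵥ x) := by
    field_simp
    ring
  have := mul_nonneg (inv_nonneg.2 hα.le) h
  linarith

/-- V dominates r times the identity. It makes the width at most 1 as soon as ‖u‖² ≤ r. -/
theorem dotProduct_inv_regGram_mulVec_le {r : ℝ} (hr : 0 < r) (v : ℕ → Fin d → ℝ) (n : ℕ)
    (u : Fin d → ℝ) : u ⬝ᵥ (regGram r v n)⁻¹ *ᵥ u ≤ r⁻¹ * (u ⬝ᵥ u) := by
  set z := (regGram r v n)⁻¹ *ᵥ u with hz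
  have hzu : regGram r v n *ᵥ z = u := regGram_mulVec_inv_mulVec hr v n u
  have h1 : r * (z ⬝ᵥ z) ≤ u ⬝ᵥ z := by
    have h := dotProduct_regGram_mulVec r v n z
    rw [hzu, dotProduct_comm] at h
    have := Finset.sum_nonneg fun k (_ : k ∈ Finset.range n) => sq_nonneg (v k ⬝ᵥ z)
    linarith
  have h2 := dotProduct_self_nonneg' (u - r • z)
  rw [sub_dotProduct, dotProduct_sub, dotProduct_sub, smul_dotProduct, smul_dotProduct,
    dotProduct_smul, dotProduct_smul, dotProduct_comm z u] at h2
  simp only [smul_eq_mul] at h2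
  have h3 : r * (r * (z ⬝ᵥ z)) ≤ r * (u ⬝ᵥ z) := mul_le_mul_of_nonneg_left h1 hr.le
  rw [← div_eq_inv_mul, le_div_iff₀ hr]
  linarith

/-- The error of ridge regression in the norm of the regularized Gram matrix. -/
theorem ridge_error_le {r : ℝ} (hr : 0 < r) (v : ℕ → Fin d → ℝ) (y : ℕ → ℝ) (n : ℕ)
    (θ : Fin d → ℝ) :
    (θ - ridge r v y n) ⬝ᵥ regGram r v n *ᵥ (θ - ridge r v y n) ≤
      r * (θ ⬝ᵥ θ) + ∑ k ∈ Finset.range n, (v k ⬝ᵥ θ - y k) ^ 2 := by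
  set x := θ - ridge r v y n with hx
  -- The normal equations. Pairing them with `x` and applying Young's inequality termwise leaves
  -- half of the quadratic form of `x` on the right, which is then absorbed.
  have hV : regGram r v n *ᵥ x = r • θ + ∑ k ∈ Finset.range n, (v k ⬝ᵥ θ - y k) • v k := by
    rw [hx, mulVec_sub, ridge, regGram_mulVec_inv_mulVec hr, regGram_mulVec]
    simp only [sub_smul, Finset.sum_sub_distrib]
    abel
  have h1 : x ⬝ᵥ regGram r v n *ᵥ x =
      r * (x ⬝ᵥ θ) + ∑ k ∈ Finset.range n, (v k ⬝ᵥ θ - y k) * (v k ⬝ᵥ x) := by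
    rw [hV, dotProduct_add, dotProduct_smul, dotProduct_sum, smul_eq_mul]
    congr 1
    refine Finset.sum_congr rfl fun k _ => ?_
    rw [dotProduct_smul, dotProduct_comm x, smul_eq_mul]
  have h2 := dotProduct_regGram_mulVec r v n x
  have h3 : ∑ k ∈ Finset.range n, (v k ⬝ᵥ θ - y k) * (v k ⬝ᵥ x) ≤
      (∑ k ∈ Finset.range n, (v k ⬝ᵥ θ - y k) ^ 2) / 2 +
        (∑ k ∈ Finset.range n, (v k ⬝ᵥ x) ^ 2) / 2 := by
    rw [← add_div, ← Finset.sum_add_distrib, Finset.sum_div]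
    refine Finset.sum_le_sum fun k _ => ?_
    nlinarith [sq_nonneg (v k ⬝ᵥ θ - y k - v k ⬝ᵥ x)]
  have h4 : 2 * (x ⬝ᵥ θ) ≤ x ⬝ᵥ x + θ ⬝ᵥ θ := by
    have := dotProduct_self_nonneg' (x - θ)
    clear_value x
    rw [sub_dotProduct, dotProduct_sub, dotProduct_sub, dotProduct_comm θ x] at this
    linarith
  have h5 := mul_le_mul_of_nonneg_left h4 hr.le
  linarith

/-- Matrix determinant lemma: log(1 + width) is an increment of log det V and telescopes. -/
theorem det_regGram_succ {r : ℝ} (hr : 0 < r) (v : ℕ → Fin d → ℝ) (n : ℕ) :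
    (regGram r v (n + 1)).det =
      (regGram r v n).det * (1 + v n ⬝ᵥ (regGram r v n)⁻¹ *ᵥ v n) := by
  have h : regGram r v (n + 1) =
      regGram r v n + replicateCol Unit (v n) * replicateRow Unit (v n) := by
    rw [regGram, regGram, Finset.sum_range_succ, ← add_assoc, vecMulVec_eq Unit]
  rw [h, det_add_replicateCol_mul_replicateRow (posDef_regGram hr v n).det_pos.ne'.isUnit]
  congr 1
  rw [det_unique]
  simp [Matrix.mul_apply, dotProduct, mulVec, Finset.sum_mul, Finset.mul_sum]
  rw [Finset.sum_comm]
  exact Finset.sum_congr rfl fun _ _ => Finset.sum_congr rfl fun _ _ => by ring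

theorem trace_regGram_le {r : ℝ} (v : ℕ → Fin d → ℝ) (hv : ∀ k, v k ⬝ᵥ v k ≤ r) (n : ℕ) :
    (regGram r v n).trace ≤ r * (d + n) := by
  rw [regGram, trace_add, trace_smul, trace_one, trace_sum]
  have : ∑ k ∈ Finset.range n, (vecMulVec (v k) (v k)).trace ≤ ∑ _k ∈ Finset.range n, r :=
    Finset.sum_le_sum fun k _ => by rw [trace_vecMulVec]; exact hv k
  simp only [Finset.sum_const, Finset.card_range, nsmul_eq_mul, Fintype.card_fin,
    smul_eq_mul] at this ⊢
  linarith

/-- Each eigenvalue is at most the trace. This is cruder than the AM-GM inequality, but the loss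
stays inside a logarithm. -/
theorem Matrix.PosDef.det_le_trace_pow {A : Matrix (Fin d) (Fin d) ℝ} (hA : A.PosDef) :
    A.det ≤ A.trace ^ d := by
  have h0 : ∀ i, 0 ≤ hA.isHermitian.eigenvalues i := fun i => (hA.eigenvalues_pos i).le
  have ht : A.trace = ∑ i, hA.isHermitian.eigenvalues i := by
    simpa using hA.isHermitian.trace_eq_sum_eigenvalues
  have hd : A.det = ∏ i, hA.isHermitian.eigenvalues i := by
    simpa using hA.isHermitian.det_eq_prod_eigenvalues
  rw [hd]
  calc ∏ i, hA.isHermitian.eigenvalues i ≤ ∏ _i : Fin d, A.trace := by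
        refine Finset.prod_le_prod (fun i _ => h0 i) fun i _ => ?_
        rw [ht]
        exact Finset.single_le_sum (fun i _ => h0 i) (Finset.mem_univ i)
    _ = A.trace ^ d := by simp

/-- The elliptical potential lemma. -/
theorem sum_dotProduct_inv_regGram_le {r : ℝ} (hr : 0 < r) (v : ℕ → Fin d → ℝ)
    (hv : ∀ k, v k ⬝ᵥ v k ≤ r) (n : ℕ) (hn : 0 < n) :
    ∑ k ∈ Finset.range n, v k ⬝ᵥ (regGram r v k)⁻¹ *ᵥ v k ≤ 2 * d * Real.log (d + n) := by
  -- For a width w in [0, 1], w/2 ≤ w/(1 + w) ≤ log(1 + w).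
  have hstep : ∀ k, v k ⬝ᵥ (regGram r v k)⁻¹ *ᵥ v k ≤
      2 * (Real.log (regGram r v (k + 1)).det - Real.log (regGram r v k).det) := by
    intro k
    set w := v k ⬝ᵥ (regGram r v k)⁻¹ *ᵥ v k with hw
    have hw0 : 0 ≤ w := dotProduct_inv_regGram_mulVec_nonneg hr v k (v k)
    have hw1 : w ≤ 1 := by
      refine (dotProduct_inv_regGram_mulVec_le hr v k (v k)).trans ?_
      rw [← div_eq_inv_mul, div_le_one hr]
      exact hv k
    rw [det_regGram_succ hr, ← hw, Real.log_mul (posDef_regGram hr v k).det_pos.ne' (by linarith)]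
    have h := Real.one_sub_inv_le_log_of_pos (show 0 < 1 + w by linarith)
    have h' : w / 2 ≤ 1 - (1 + w)⁻¹ := by
      rw [show 1 - (1 + w)⁻¹ = w / (1 + w) by field_simp; ring]
      exact div_le_div_of_nonneg_left hw0 (by linarith) (by linarith)
    linarith
  have hsum := Finset.sum_le_sum fun k (_ : k ∈ Finset.range n) => hstep k
  rw [← Finset.mul_sum, Finset.sum_range_sub fun k => Real.log (regGram r v k).det] at hsum
  have h0 : Real.log (regGram r v 0).det = d * Real.log r := by
    simp [regGram]
  have hpos : (0 : ℝ) < d + n := by positivity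
  have hN : Real.log (regGram r v n).det ≤ d * Real.log r + d * Real.log (d + n) := by
    have h1 : (regGram r v n).det ≤ (r * (d + n)) ^ d :=
      (posDef_regGram hr v n).det_le_trace_pow.trans
        (pow_le_pow_left₀ (posDef_regGram hr v n).posSemidef.trace_nonneg
          (trace_regGram_le v hv n) d)
    refine (Real.log_le_log (posDef_regGram hr v n).det_pos h1).trans_eq ?_
    rw [Real.log_pow, Real.log_mul hr.ne' hpos.ne']
    ring
  rw [h0] at hsum
  linarith

end Matrices

/-! ### Exponentially weighted aggregation for the squared loss -/

section Aggregation

variable {ι : Type*}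

/-- The weights of the exponentially weighted average forecaster for the squared loss, with
learning rate `η`, prior weights `p`, experts `g` and responses `y`. -/
noncomputable def expWeight (η : ℝ) (p : ι → ℝ) (g : ι → ℕ → ℝ) (y : ℕ → ℝ) (n : ℕ) (i : ι) : ℝ :=
  p i * Real.exp (-η * ∑ k ∈ Finset.range n, (y k - g i k) ^ 2)

variable {η : ℝ} {p : ι → ℝ}

theorem expWeight_pos (hp : ∀ i, 0 < p i) (g : ι → ℕ → ℝ) (y : ℕ → ℝ) (n : ℕ) (i : ι) :
    0 < expWeight η p g y n i :=
  mul_pos (hp i) (Real.exp_pos _)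

theorem expWeight_succ (g : ι → ℕ → ℝ) (y : ℕ → ℝ) (n : ℕ) (i : ι) :
    expWeight η p g y (n + 1) i =
      expWeight η p g y n i * Real.exp (-η * (y n - g i n) ^ 2) := by
  rw [expWeight, expWeight, Finset.sum_range_succ, mul_add, Real.exp_add, mul_assoc]

theorem measurable_expWeight {Ω : Type*} {M : MeasurableSpace Ω} {g : ι → ℕ → Ω → ℝ}
    {y : ℕ → Ω → ℝ} {n : ℕ} (hg : ∀ i, ∀ k < n, Measurable (g i k))
    (hy : ∀ k < n, Measurable (y k)) (i : ι) :
    Measurable fun ω => expWeight η p (fun i k => g i k ω) (fun k => y k ω) n i := by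
  refine Measurable.const_mul (Measurable.exp (Measurable.const_mul ?_ _)) _
  refine Finset.measurable_sum _ fun k hk => ?_
  have h1 := hg i k (Finset.mem_range.1 hk)
  have h2 := hy k (Finset.mem_range.1 hk)
  fun_prop

variable [Fintype ι]

/-- The exponentially weighted average forecaster. -/
noncomputable def expForecast (η : ℝ) (p : ι → ℝ) (g : ι → ℕ → ℝ) (y : ℕ → ℝ) (n : ℕ) : ℝ :=
  ∑ i, expWeight η p g y n i / (∑ j, expWeight η p g y n j) * g i n

theorem sum_expWeight_pos [Nonempty ι] (hp : ∀ i, 0 < p i) (g : ι → ℕ → ℝ) (y : ℕ → ℝ) (n : ℕ) :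
    0 < ∑ i, expWeight η p g y n i :=
  Finset.sum_pos (fun i _ => expWeight_pos hp g y n i) Finset.univ_nonempty

theorem sum_expWeight_div [Nonempty ι] (hp : ∀ i, 0 < p i) (g : ι → ℕ → ℝ) (y : ℕ → ℝ) (n : ℕ) :
    ∑ i, expWeight η p g y n i / (∑ j, expWeight η p g y n j) = 1 := by
  rw [← Finset.sum_div, div_self (sum_expWeight_pos hp g y n).ne']

theorem expWeight_div_nonneg [Nonempty ι] (hp : ∀ i, 0 < p i) (g : ι → ℕ → ℝ) (y : ℕ → ℝ) (n : ℕ)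
    (i : ι) : 0 ≤ expWeight η p g y n i / (∑ j, expWeight η p g y n j) :=
  div_nonneg (expWeight_pos hp g y n i).le (sum_expWeight_pos hp g y n).le

theorem expWeight_div_le_one [Nonempty ι] (hp : ∀ i, 0 < p i) (g : ι → ℕ → ℝ) (y : ℕ → ℝ) (n : ℕ)
    (i : ι) : expWeight η p g y n i / (∑ j, expWeight η p g y n j) ≤ 1 := by
  rw [← sum_expWeight_div (η := η) hp g y n]
  exact Finset.single_le_sum (fun j _ => expWeight_div_nonneg hp g y n j) (Finset.mem_univ i)

theorem abs_expForecast_le [Nonempty ι] (hp : ∀ i, 0 < p i) {g : ι → ℕ → ℝ} (y : ℕ → ℝ) (n : ℕ)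
    {B : ℝ} (hg : ∀ i, |g i n| ≤ B) : |expForecast η p g y n| ≤ B := by
  refine (Finset.abs_sum_le_sum_abs _ _).trans ?_
  calc _ ≤ ∑ i, expWeight η p g y n i / (∑ j, expWeight η p g y n j) * B := by
        refine Finset.sum_le_sum fun i _ => ?_
        rw [abs_mul, abs_of_nonneg (expWeight_div_nonneg hp g y n i)]
        exact mul_le_mul_of_nonneg_left (hg i) (expWeight_div_nonneg hp g y n i)
    _ = B := by rw [← Finset.sum_mul, sum_expWeight_div hp, one_mul]

/-- Jensen's inequality, obtained from the bias-variance decomposition around the forecast. -/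
theorem sq_sub_expForecast_le [Nonempty ι] (hp : ∀ i, 0 < p i) (g : ι → ℕ → ℝ) (y : ℕ → ℝ) (n : ℕ)
    (m : ℝ) : (m - expForecast η p g y n) ^ 2 ≤
      ∑ i, expWeight η p g y n i / (∑ j, expWeight η p g y n j) * (m - g i n) ^ 2 := by
  set q : ι → ℝ := fun i => expWeight η p g y n i / (∑ j, expWeight η p g y n j) with hq
  set f := expForecast η p g y n with hf
  have h1 : ∑ i, q i = 1 := sum_expWeight_div hp g y n
  have h2 : ∑ i, q i * g i n = f := rfl
  have h3 : 0 ≤ ∑ i, q i * (f - g i n) ^ 2 :=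
    Finset.sum_nonneg fun i _ => mul_nonneg (expWeight_div_nonneg hp g y n i) (sq_nonneg _)
  have h4 : ∑ i, q i * (m - g i n) ^ 2 =
      (m - f) ^ 2 * ∑ i, q i + 2 * (m - f) * (f * ∑ i, q i - ∑ i, q i * g i n) +
        ∑ i, q i * (f - g i n) ^ 2 := by
    simp only [Finset.mul_sum, ← Finset.sum_sub_distrib, ← Finset.sum_add_distrib]
    exact Finset.sum_congr rfl fun i _ => by ring
  change _ ≤ ∑ i, q i * (m - g i n) ^ 2
  rw [h4, h1, h2]
  linarith

/-- The loss of each expert is expanded around `m`, and log X ≤ X - 1 leaves an expression linear in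
exponentials, to which the sub-Gaussian bound applies. The term in `(y n - m) ^ 2`, which need not
be bounded, is common to all experts. -/
theorem log_sum_expWeight_succ_le [Nonempty ι] (hp : ∀ i, 0 < p i) (g : ι → ℕ → ℝ) (y : ℕ → ℝ)
    (n : ℕ) (m : ℝ) :
    Real.log (∑ i, expWeight η p g y (n + 1) i) ≤ Real.log (∑ i, expWeight η p g y n i) -
      η * (y n - m) ^ 2 +
      (∑ i, expWeight η p g y n i / (∑ j, expWeight η p g y n j) *
        (Real.exp (-η * (m - g i n) ^ 2) *
          Real.exp (-2 * η * (m - g i n) * (y n - m))) - 1) := by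
  set Z := ∑ i, expWeight η p g y n i with hZ
  have hZ0 : 0 < Z := sum_expWeight_pos hp g y n
  set X := ∑ i, expWeight η p g y n i / Z *
    (Real.exp (-η * (m - g i n) ^ 2) * Real.exp (-2 * η * (m - g i n) * (y n - m))) with hX
  have hX0 : 0 < X := Finset.sum_pos (fun i _ =>
    mul_pos (div_pos (expWeight_pos hp g y n i) hZ0) (by positivity)) Finset.univ_nonempty
  have h : ∑ i, expWeight η p g y (n + 1) i = Z * Real.exp (-η * (y n - m) ^ 2) * X := by
    rw [hX, Finset.mul_sum]
    refine Finset.sum_congr rfl fun i _ => ?_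
    rw [expWeight_succ, show -η * (y n - g i n) ^ 2 = -η * (y n - m) ^ 2 +
      (-η * (m - g i n) ^ 2 + -2 * η * (m - g i n) * (y n - m)) by ring, Real.exp_add, Real.exp_add]
    field_simp
  rw [h, Real.log_mul (by positivity) hX0.ne', Real.log_mul hZ0.ne' (Real.exp_pos _).ne',
    Real.log_exp]
  have := Real.log_le_sub_one_of_pos hX0
  linarith

/-- The pathwise regret bound of the exponentially weighted average forecaster. -/
theorem log_prior_le_sum [Nonempty ι] (hp : ∀ i, 0 < p i) (g : ι → ℕ → ℝ) (y m : ℕ → ℝ)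
    (n : ℕ) (i₀ : ι) :
    Real.log (p i₀) - Real.log (∑ i, p i) -
        η * ∑ k ∈ Finset.range n, (2 * ((m k - g i₀ k) * (y k - m k)) + (m k - g i₀ k) ^ 2) ≤
      ∑ k ∈ Finset.range n, (∑ i, expWeight η p g y k i / (∑ j, expWeight η p g y k j) *
        (Real.exp (-η * (m k - g i k) ^ 2) *
          Real.exp (-2 * η * (m k - g i k) * (y k - m k))) - 1) := by
  have h1 : ∀ n, Real.log (∑ i, expWeight η p g y n i) ≤ Real.log (∑ i, p i) -
      η * ∑ k ∈ Finset.range n, (y k - m k) ^ 2 +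
      ∑ k ∈ Finset.range n, (∑ i, expWeight η p g y k i / (∑ j, expWeight η p g y k j) *
        (Real.exp (-η * (m k - g i k) ^ 2) *
          Real.exp (-2 * η * (m k - g i k) * (y k - m k))) - 1) := by
    intro n
    induction n with
    | zero => simp [expWeight]
    | succ n ih =>
      rw [Finset.sum_range_succ, Finset.sum_range_succ]
      have := log_sum_expWeight_succ_le (η := η) hp g y n (m n)
      linarith
  -- The total weight is at least the weight of the single expert `i₀`; the sums of `(y k - m k) ^
  -- 2` in this lower bound and in `h1` cancel.
  have h2 : Real.log (p i₀) - η * ∑ k ∈ Finset.range n, (y k - g i₀ k) ^ 2 ≤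
      Real.log (∑ i, expWeight η p g y n i) := by
    have : Real.log (expWeight η p g y n i₀) =
        Real.log (p i₀) - η * ∑ k ∈ Finset.range n, (y k - g i₀ k) ^ 2 := by
      rw [expWeight, Real.log_mul (hp i₀).ne' (Real.exp_pos _).ne', Real.log_exp]
      ring
    rw [← this]
    exact Real.log_le_log (expWeight_pos hp g y n i₀)
      (Finset.single_le_sum (fun i _ => (expWeight_pos hp g y n i).le) (Finset.mem_univ i₀))
  have h3 : ∑ k ∈ Finset.range n, (y k - g i₀ k) ^ 2 = ∑ k ∈ Finset.range n, (y k - m k) ^ 2 +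
      ∑ k ∈ Finset.range n, (2 * ((m k - g i₀ k) * (y k - m k)) + (m k - g i₀ k) ^ 2) := by
    rw [← Finset.sum_add_distrib]
    exact Finset.sum_congr rfl fun k _ => by ring
  have h4 := h1 n
  rw [h3, mul_add] at h2
  linarith

theorem measurable_expForecast {Ω : Type*} {M : MeasurableSpace Ω} {g : ι → ℕ → Ω → ℝ}
    {y : ℕ → Ω → ℝ} {n : ℕ} (hg : ∀ i, ∀ k ≤ n, Measurable (g i k))
    (hy : ∀ k < n, Measurable (y k)) :
    Measurable fun ω => expForecast η p (fun i k => g i k ω) (fun k => y k ω) n := by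
  have h := measurable_expWeight (η := η) (p := p) (fun i k hk => hg i k hk.le) hy
  refine Finset.measurable_sum _ fun i _ => ?_
  exact ((h i).div (Finset.measurable_sum _ fun j _ => h j)).mul (hg i n le_rfl)

/-- From exp(-u) ≤ 1/(1 + u). It turns the exponential gain of an expert into a linear one. -/
theorem Real.exp_neg_le_one_sub_div {u U : ℝ} (hu : 0 ≤ u) (hU : u ≤ U) :
    Real.exp (-u) ≤ 1 - u / (1 + U) := by
  have h1 : Real.exp (-u) ≤ (1 + u)⁻¹ := by
    rw [Real.exp_neg]
    exact inv_anti₀ (by linarith) (by linarith [Real.add_one_le_exp u])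
  have h2 : (1 + u)⁻¹ = 1 - u / (1 + u) := by
    field_simp
    ring
  have h3 : u / (1 + U) ≤ u / (1 + u) := div_le_div_of_nonneg_left hu (by linarith) (by linarith)
  linarith

variable {Ω : Type*} {G₀ mΩ : MeasurableSpace Ω} {μ : Measure Ω}

/-- Averaging over the noise costs a factor exp(η/2 (m - g)²), half of the gain exp(-η (m - g)²).
What remains is linearized and passed to the forecast by Jensen's inequality. -/
theorem integral_exp_step_le [Nonempty ι] [IsProbabilityMeasure μ]
    (hG : G₀ ≤ mΩ) {σ B : ℝ} (hσ : 0 < σ) (hη : η = 1 / (4 * σ ^ 2)) (hp : ∀ i, 0 < p i)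
    {y m : ℕ → Ω → ℝ} {g : ι → ℕ → Ω → ℝ} {n : ℕ}
    (hy : ∀ k < n, Measurable[G₀] (y k)) (hyn : Measurable (y n)) (hm : Measurable[G₀] (m n))
    (hg : ∀ i, ∀ k ≤ n, Measurable[G₀] (g i k)) (hmB : ∀ ω, |m n ω| ≤ B)
    (hgB : ∀ i ω, |g i n ω| ≤ B)
    (hsub : IsCondSubGaussian μ G₀ (fun ω => y n ω - m n ω) σ) :
    Integrable (fun ω => ∑ i, expWeight η p (fun i k => g i k ω) (fun k => y k ω) n i /
        (∑ j, expWeight η p (fun i k => g i k ω) (fun k => y k ω) n j) *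
        (Real.exp (-η * (m n ω - g i n ω) ^ 2) *
          Real.exp (-2 * η * (m n ω - g i n ω) * (y n ω - m n ω)))) μ ∧
    ∫ ω, ∑ i, expWeight η p (fun i k => g i k ω) (fun k => y k ω) n i /
        (∑ j, expWeight η p (fun i k => g i k ω) (fun k => y k ω) n j) *
        (Real.exp (-η * (m n ω - g i n ω) ^ 2) *
          Real.exp (-2 * η * (m n ω - g i n ω) * (y n ω - m n ω))) ∂μ ≤
      1 - η / 2 / (1 + 2 * η * B ^ 2) *
        ∫ ω, (m n ω - expForecast η p (fun i k => g i k ω) (fun k => y k ω) n) ^ 2 ∂μ := by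
  have hη0 : 0 < η := by rw [hη]; positivity
  set q : ι → Ω → ℝ := fun i ω => expWeight η p (fun i k => g i k ω) (fun k => y k ω) n i /
        (∑ j, expWeight η p (fun i k => g i k ω) (fun k => y k ω) n j) with hq
  have hq0 : ∀ i ω, 0 ≤ q i ω := fun i ω => expWeight_div_nonneg hp _ _ n i
  have hq1 : ∀ i ω, q i ω ≤ 1 := fun i ω => expWeight_div_le_one hp _ _ n i
  have hqm : ∀ i, Measurable[G₀] (q i) := fun i => by
    have h := measurable_expWeight (M := G₀) (η := η) (p := p) (fun i k hk => hg i k (le_of_lt hk)) hy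
    exact (h i).div (Finset.measurable_sum _ fun j _ => h j)
  have hdm : ∀ i, Measurable[G₀] fun ω => m n ω - g i n ω := fun i => hm.sub (hg i n le_rfl)
  have hdB : ∀ i ω, |m n ω - g i n ω| ≤ 2 * B := fun i ω =>
    (abs_sub _ _).trans (by linarith [hmB ω, hgB i ω])
  have hhm : ∀ i, Measurable[G₀] fun ω => q i ω * Real.exp (-η * (m n ω - g i n ω) ^ 2) := fun i =>
    (hqm i).mul (((hdm i).pow_const 2).const_mul (-η)).exp
  have hh0 : ∀ i ω, 0 ≤ q i ω * Real.exp (-η * (m n ω - g i n ω) ^ 2) := fun i ω =>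
    mul_nonneg (hq0 i ω) (Real.exp_pos _).le
  have hh1 : ∀ i ω, q i ω * Real.exp (-η * (m n ω - g i n ω) ^ 2) ≤ 1 := fun i ω =>
    mul_le_one₀ (hq1 i ω) (Real.exp_pos _).le
      (Real.exp_le_one_iff.2 (by nlinarith [sq_nonneg (m n ω - g i n ω)]))
  have hlm : ∀ i, Measurable[G₀] fun ω => -2 * η * (m n ω - g i n ω) := fun i =>
    (hdm i).const_mul _
  have hlB : ∀ i ω, |-2 * η * (m n ω - g i n ω)| ≤ 2 * η * (2 * B) := fun i ω => by
    rw [abs_mul, abs_mul, abs_of_pos hη0]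
    norm_num
    exact mul_le_mul_of_nonneg_left (hdB i ω) (by positivity)
  have hYm : Measurable fun ω => y n ω - m n ω := hyn.sub (hm.mono hG le_rfl)
  have hi : ∀ i, Integrable (fun ω => q i ω * (Real.exp (-η * (m n ω - g i n ω) ^ 2) *
      Real.exp (-2 * η * (m n ω - g i n ω) * (y n ω - m n ω)))) μ := fun i => by
    simp_rw [← mul_assoc (q i _)]
    exact hsub.integrable_mul_exp hYm ((hhm i).mono hG le_rfl) ((hlm i).mono hG le_rfl)
      (fun ω => by rw [abs_of_nonneg (hh0 i ω)]; exact hh1 i ω) (hlB i)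
  refine ⟨integrable_finsetSum _ fun i _ => hi i, ?_⟩
  set c := η / 2 / (1 + 2 * η * B ^ 2) with hc
  have hB1 : 0 < 1 + 2 * η * B ^ 2 := by positivity
  have hc0 : 0 ≤ c := by positivity
  have hdi : ∀ i, Integrable (fun ω => q i ω * (1 - c * (m n ω - g i n ω) ^ 2)) μ := fun i => by
    have h1 := (hqm i).mono hG le_rfl
    have h2 := (hdm i).mono hG le_rfl
    refine Integrable.of_bound (Measurable.aestronglyMeasurable (by fun_prop))
      (1 * (1 + c * (2 * B) ^ 2)) (Filter.Eventually.of_forall fun ω => ?_)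
    rw [norm_mul, Real.norm_eq_abs, Real.norm_eq_abs, abs_of_nonneg (hq0 i ω)]
    refine mul_le_mul (hq1 i ω) ?_ (abs_nonneg _) zero_le_one
    have h3 : (m n ω - g i n ω) ^ 2 ≤ (2 * B) ^ 2 := sq_le_sq.2 ((hdB i ω).trans (le_abs_self _))
    have h4 := mul_le_mul_of_nonneg_left h3 hc0
    have h5 := mul_nonneg hc0 (sq_nonneg (m n ω - g i n ω))
    exact abs_le.2 ⟨by linarith, by linarith⟩
  have hstep : ∀ i, ∫ ω, q i ω * (Real.exp (-η * (m n ω - g i n ω) ^ 2) *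
      Real.exp (-2 * η * (m n ω - g i n ω) * (y n ω - m n ω))) ∂μ ≤
      ∫ ω, q i ω * (1 - c * (m n ω - g i n ω) ^ 2) ∂μ := fun i => by
    have h1 := hsub.integral_mul_exp_le hG hYm (hhm i) (hlm i) (hh0 i) (hh1 i) (hlB i)
    simp_rw [mul_assoc (q i _)] at h1
    refine h1.trans (integral_mono_of_nonneg (Filter.Eventually.of_forall fun ω => ?_) (hdi i)
      (Filter.Eventually.of_forall fun ω => ?_))
    · exact mul_nonneg (hq0 i ω) (by positivity)
    · refine mul_le_mul_of_nonneg_left ?_ (hq0 i ω)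
      rw [← Real.exp_add]
      -- The choice of `η` gives 2η²σ² = η/2.
      have h2 : -η * (m n ω - g i n ω) ^ 2 + (-2 * η * (m n ω - g i n ω)) ^ 2 * σ ^ 2 / 2 =
          -(η / 2 * (m n ω - g i n ω) ^ 2) := by
        rw [hη]
        field_simp
        ring
      rw [h2]
      have h3 : (m n ω - g i n ω) ^ 2 ≤ (2 * B) ^ 2 :=
        sq_le_sq.2 ((hdB i ω).trans (le_abs_self _))
      have h4 : η / 2 * (m n ω - g i n ω) ^ 2 ≤ 2 * η * B ^ 2 := by nlinarith
      refine (Real.exp_neg_le_one_sub_div (by positivity) h4).trans_eq ?_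
      rw [hc]
      ring
  rw [integral_finsetSum _ fun i _ => hi i]
  refine (Finset.sum_le_sum fun i _ => hstep i).trans ?_
  rw [← integral_finsetSum _ fun i _ => hdi i, ← integral_const_mul]
  have hfm : Measurable fun ω => expForecast η p (fun i k => g i k ω) (fun k => y k ω) n :=
    (measurable_expForecast (M := G₀) hg hy).mono hG le_rfl
  have hfB : ∀ ω, |m n ω - expForecast η p (fun i k => g i k ω) (fun k => y k ω) n| ≤ 2 * B :=
    fun ω => (abs_sub _ _).trans (by
      linarith [hmB ω, abs_expForecast_le (η := η) hp (g := fun i k => g i k ω)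
        (fun k => y k ω) n (fun i => hgB i ω)])
  have hfi : Integrable (fun ω => c *
      (m n ω - expForecast η p (fun i k => g i k ω) (fun k => y k ω) n) ^ 2) μ := by
    have := hm.mono hG le_rfl
    refine (Integrable.of_bound (Measurable.aestronglyMeasurable (by fun_prop)) ((2 * B) ^ 2)
      (Filter.Eventually.of_forall fun ω => ?_)).const_mul c
    rw [norm_pow, Real.norm_eq_abs]
    exact pow_le_pow_left₀ (abs_nonneg _) (hfB ω) 2
  have hone : (1 : ℝ) = ∫ _, (1 : ℝ) ∂μ := by simp
  rw [hone, ← integral_sub (integrable_const _) hfi, ← hone]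
  refine integral_mono (integrable_finsetSum _ fun i _ => hdi i)
    ((integrable_const _).sub hfi) fun ω => ?_
  have h1 : ∑ i, q i ω = 1 := sum_expWeight_div hp _ _ n
  have h2 := sq_sub_expForecast_le (η := η) hp (fun i k => g i k ω) (fun k => y k ω) n (m n ω)
  have h3 := mul_le_mul_of_nonneg_left h2 hc0
  have h4 : ∑ i, q i ω * (1 - c * (m n ω - g i n ω) ^ 2) =
      ∑ i, q i ω - c * ∑ i, q i ω * (m n ω - g i n ω) ^ 2 := by
    rw [Finset.mul_sum, ← Finset.sum_sub_distrib]
    exact Finset.sum_congr rfl fun i _ => by ring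
  dsimp only
  rw [h4, h1]
  linarith

/-- The expected cumulative squared error of the exponentially weighted average forecaster in a
regression problem with bounded means `m` and sub-Gaussian noise; `J` is a random expert that is
`δ`-close to the mean. -/
theorem integral_sum_sq_sub_expForecast_le [Nonempty ι] [IsProbabilityMeasure μ]
    {G : ℕ → MeasurableSpace Ω} (hG : ∀ n, G n ≤ mΩ) {σ B δ : ℝ} (hσ : 0 < σ)
    (hη : η = 1 / (4 * σ ^ 2)) (hp : ∀ i, 0 < p i)
    {y m : ℕ → Ω → ℝ} {g : ι → ℕ → Ω → ℝ}
    (hy : ∀ n, ∀ k < n, Measurable[G n] (y k)) (hym : ∀ n, Measurable (y n))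
    (hm : ∀ n, Measurable[G n] (m n))
    (hg : ∀ n i, ∀ k ≤ n, Measurable[G n] (g i k)) (hmB : ∀ n ω, |m n ω| ≤ B)
    (hgB : ∀ i n ω, |g i n ω| ≤ B)
    (hsub : ∀ n, IsCondSubGaussian μ (G n) (fun ω => y n ω - m n ω) σ)
    {J : Ω → ι} (hJ : ∀ n i, MeasurableSet[G n] (J ⁻¹' {i}))
    (hJδ : ∀ᵐ ω ∂μ, ∀ n, |m n ω - g (J ω) n ω| ≤ δ) (n : ℕ) :
    η / 2 / (1 + 2 * η * B ^ 2) * ∫ ω, ∑ k ∈ Finset.range n,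
        (m k ω - expForecast η p (fun i k => g i k ω) (fun k => y k ω) k) ^ 2 ∂μ ≤
      ∫ ω, (Real.log (∑ i, p i) - Real.log (p (J ω))) ∂μ + η * (n * δ ^ 2) := by
  have hη0 : 0 < η := by rw [hη]; positivity
  set c := η / 2 / (1 + 2 * η * B ^ 2) with hc
  have hstep := fun k => integral_exp_step_le (hG k) hσ hη hp (hy k) (hym k) (hm k) (hg k) (hmB k)
    (fun i => hgB i k) (hsub k)
  have hcomp : ∀ {M : MeasurableSpace Ω} (_ : ∀ i, MeasurableSet[M] (J ⁻¹' {i})) (F : ι → Ω → ℝ),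
      (∀ i, Measurable[M] (F i)) → Measurable[M] fun ω => F (J ω) ω := by
    classical
    intro M hJM F hF
    have : (fun ω => F (J ω) ω) = fun ω => ∑ i, (J ⁻¹' {i}).indicator (F i) ω := by
      ext ω
      rw [Finset.sum_eq_single (J ω), Set.indicator_of_mem (by simp)]
      · intro i _ hi
        exact Set.indicator_of_notMem (by simpa using hi.symm) _
      · simp
    rw [this]
    exact Finset.measurable_sum _ fun i _ => (hF i).indicator (hJM i)
  have hDm : ∀ k, Measurable[G k] fun ω => m k ω - g (J ω) k ω := fun k =>
    (hm k).sub (hcomp (hJ k) (fun i => g i k) fun i => hg k i k le_rfl)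
  have hDB : ∀ k ω, |m k ω - g (J ω) k ω| ≤ 2 * B := fun k ω =>
    (abs_sub _ _).trans (by linarith [hmB k ω, hgB (J ω) k ω])
  have hYm : ∀ k, Measurable fun ω => y k ω - m k ω := fun k =>
    (hym k).sub ((hm k).mono (hG k) le_rfl)
  have hDY := fun k => (hsub k).integrable_mul (hYm k) ((hDm k).mono (hG k) le_rfl) (hDB k)
  -- The comparator `J` is random but `G k`-measurable, so its cross term with the noise still has
  -- mean zero.
  have hDY0 := fun k => (hsub k).integral_mul_eq_zero (hG k) (hYm k) (hDm k) (hDB k)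
  have hD2 : ∀ k, Integrable (fun ω => (m k ω - g (J ω) k ω) ^ 2) μ := fun k => by
    refine Integrable.of_bound
      (((hDm k).mono (hG k) le_rfl).pow_const 2).aestronglyMeasurable ((2 * B) ^ 2)
      (Filter.Eventually.of_forall fun ω => ?_)
    rw [norm_pow, Real.norm_eq_abs]
    exact pow_le_pow_left₀ (abs_nonneg _) (hDB k ω) 2
  have hD2δ : ∀ k, ∫ ω, (m k ω - g (J ω) k ω) ^ 2 ∂μ ≤ δ ^ 2 := fun k => by
    have h : ∫ ω, (m k ω - g (J ω) k ω) ^ 2 ∂μ ≤ ∫ _, δ ^ 2 ∂μ :=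
      integral_mono_ae (hD2 k) (integrable_const _) (by
        filter_upwards [hJδ] with ω hω
        exact sq_le_sq.2 ((hω k).trans (le_abs_self δ)))
    simpa using h
  have hterm : ∀ k, Integrable (fun ω => 2 * ((m k ω - g (J ω) k ω) * (y k ω - m k ω)) +
      (m k ω - g (J ω) k ω) ^ 2) μ := fun k => ((hDY k).const_mul 2).add (hD2 k)
  have hlogm : Measurable fun ω => Real.log (∑ i, p i) - Real.log (p (J ω)) :=
    hcomp (fun i => hG 0 _ (hJ 0 i)) (fun i _ => Real.log (∑ i, p i) - Real.log (p i))
      fun i => measurable_const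
  have hlogi : Integrable (fun ω => Real.log (∑ i, p i) - Real.log (p (J ω))) μ := by
    refine Integrable.of_bound hlogm.aestronglyMeasurable
      (∑ i, |Real.log (∑ i, p i) - Real.log (p i)|) (Filter.Eventually.of_forall fun ω => ?_)
    rw [Real.norm_eq_abs]
    exact Finset.single_le_sum (f := fun i => |Real.log (∑ i, p i) - Real.log (p i)|)
      (fun i _ => abs_nonneg _) (Finset.mem_univ (J ω))
  have hfi : ∀ k, Integrable (fun ω =>
      (m k ω - expForecast η p (fun i k => g i k ω) (fun k => y k ω) k) ^ 2) μ := fun k => by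
    have h1 := (measurable_expForecast (M := G k) (η := η) (p := p) (hg k) (hy k)).mono (hG k) le_rfl
    have h2 := (hm k).mono (hG k) le_rfl
    refine Integrable.of_bound (Measurable.aestronglyMeasurable (by fun_prop)) ((2 * B) ^ 2)
      (Filter.Eventually.of_forall fun ω => ?_)
    rw [norm_pow, Real.norm_eq_abs]
    refine pow_le_pow_left₀ (abs_nonneg _) ((abs_sub _ _).trans ?_) 2
    linarith [hmB k ω, abs_expForecast_le (η := η) hp (g := fun i k => g i k ω)
        (fun k => y k ω) k (fun i => hgB i k ω)]
  have hpath : -∫ ω, (Real.log (∑ i, p i) - Real.log (p (J ω))) ∂μ -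
      η * ∑ k ∈ Finset.range n, ∫ ω, (2 * ((m k ω - g (J ω) k ω) * (y k ω - m k ω)) +
        (m k ω - g (J ω) k ω) ^ 2) ∂μ ≤
      ∑ k ∈ Finset.range n, ((∫ ω, ∑ i, expWeight η p (fun i k => g i k ω) (fun k => y k ω) k i /
        (∑ j, expWeight η p (fun i k => g i k ω) (fun k => y k ω) k j) *
        (Real.exp (-η * (m k ω - g i k ω) ^ 2) *
          Real.exp (-2 * η * (m k ω - g i k ω) * (y k ω - m k ω))) ∂μ) - 1) := by
    have hone : (1 : ℝ) = ∫ _, (1 : ℝ) ∂μ := by simp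
    rw [hone]
    simp_rw [← integral_sub (hstep _).1 (integrable_const (1 : ℝ))]
    have hX : ∀ k, Integrable (fun ω =>
        ∑ i, expWeight η p (fun i k => g i k ω) (fun k => y k ω) k i /
          (∑ j, expWeight η p (fun i k => g i k ω) (fun k => y k ω) k j) *
          (Real.exp (-η * (m k ω - g i k ω) ^ 2) *
            Real.exp (-2 * η * (m k ω - g i k ω) * (y k ω - m k ω))) - 1) μ :=
      fun k => (hstep k).1.sub (integrable_const (1 : ℝ))
    have hneg : Integrable (fun ω => -(Real.log (∑ i, p i) - Real.log (p (J ω)))) μ := hlogi.neg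
    rw [← integral_finsetSum _ fun k _ => hterm k, ← integral_neg, ← integral_const_mul,
      ← integral_sub hneg ((integrable_finsetSum _ fun k _ => hterm k).const_mul η),
      ← integral_finsetSum _ fun k _ => hX k]
    refine integral_mono (hneg.sub ((integrable_finsetSum _ fun k _ => hterm k).const_mul η))
      (integrable_finsetSum _ fun k _ => hX k) fun ω => ?_
    have := log_prior_le_sum (η := η) hp (fun i k => g i k ω) (fun k => y k ω) (fun k => m k ω) n
      (J ω)
    dsimp only
    linarith
  have hA : ∑ k ∈ Finset.range n, ∫ ω, (2 * ((m k ω - g (J ω) k ω) * (y k ω - m k ω)) +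
        (m k ω - g (J ω) k ω) ^ 2) ∂μ ≤ n * δ ^ 2 := by
    calc _ ≤ ∑ _k ∈ Finset.range n, δ ^ 2 := by
          refine Finset.sum_le_sum fun k _ => ?_
          rw [integral_add ((hDY k).const_mul 2) (hD2 k), integral_const_mul, hDY0 k]
          linarith [hD2δ k]
      _ = n * δ ^ 2 := by simp
  have hC := Finset.sum_le_sum fun k (_ : k ∈ Finset.range n) => sub_le_sub_right (hstep k).2 1
  have hD : ∑ k ∈ Finset.range n, (1 - c * ∫ ω, (m k ω -
      expForecast η p (fun i k => g i k ω) (fun k => y k ω) k) ^ 2 ∂μ - 1) =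
      -(c * ∫ ω, ∑ k ∈ Finset.range n,
        (m k ω - expForecast η p (fun i k => g i k ω) (fun k => y k ω) k) ^ 2 ∂μ) := by
    rw [integral_finsetSum _ fun k _ => hfi k, Finset.mul_sum, ← Finset.sum_neg_distrib]
    exact Finset.sum_congr rfl fun k _ => by ring
  have hE := mul_le_mul_of_nonneg_left hA hη0.le
  rw [hD] at hC
  linarith

end Aggregation

/-! ### Exchanging actions with equal conditional laws -/

section Exchange

variable {Ω : Type*} {G mΩ : MeasurableSpace Ω} {μ : Measure Ω} {𝒜 : Type*} [MeasurableSpace 𝒜]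

/-- If `A` and `A'` have the same conditional distribution given `G`, then so do `(Z, A)` and
`(Z, A')` for every `G`-measurable `Z`. -/
theorem map_prodMk_eq_of_condExp_indicator_eq [IsFiniteMeasure μ] (hG : G ≤ mΩ) {A A' : Ω → 𝒜}
    (hA : Measurable A) (hA' : Measurable A')
    (h : ∀ B : Set 𝒜, MeasurableSet B → μ[(A ⁻¹' B).indicator (fun _ => (1 : ℝ)) | G] =ᵐ[μ]
      μ[(A' ⁻¹' B).indicator (fun _ => (1 : ℝ)) | G])
    {𝒵 : Type*} [MeasurableSpace 𝒵] {Z : Ω → 𝒵} (hZ : Measurable[G] Z) :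
    μ.map (fun ω => (Z ω, A ω)) = μ.map fun ω => (Z ω, A' ω) := by
  have hZ' : Measurable Z := hZ.mono hG le_rfl
  -- Rectangles suffice, and the mass of `S ×ˢ B` is the integral over `Z ⁻¹' S` of the conditional
  -- probability of `B`.
  refine Measure.ext_prod fun {S B} hS hB => ?_
  rw [Measure.map_apply (hZ'.prodMk hA) (hS.prod hB), Measure.map_apply (hZ'.prodMk hA') (hS.prod hB)]
  have key : ∀ {A : Ω → 𝒜}, Measurable A →
      ∫ ω in Z ⁻¹' S, (μ[(A ⁻¹' B).indicator (fun _ => (1 : ℝ)) | G]) ω ∂μ =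
        μ.real ((fun ω => (Z ω, A ω)) ⁻¹' S ×ˢ B) := by
    intro A hA
    rw [setIntegral_condExp hG ((integrable_const _).indicator (hA hB)) (hZ hS),
      integral_indicator_const _ (hA hB), smul_eq_mul, mul_one,
      measureReal_restrict_apply (hA hB)]
    congr 1
    ext ω
    simp [and_comm]
  have h' := key hA
  rw [setIntegral_congr_ae (hG _ (hZ hS)) ((h B hB).mono fun ω hω _ => hω), key hA'] at h'
  rw [measureReal_def, measureReal_def,
    ENNReal.toReal_eq_toReal_iff' (measure_ne_top _ _) (measure_ne_top _ _)] at h'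
  exact h'.symm

theorem integral_comp_eq_of_condExp_indicator_eq [IsFiniteMeasure μ] (hG : G ≤ mΩ) {A A' : Ω → 𝒜}
    (hA : Measurable A) (hA' : Measurable A')
    (h : ∀ B : Set 𝒜, MeasurableSet B → μ[(A ⁻¹' B).indicator (fun _ => (1 : ℝ)) | G] =ᵐ[μ]
      μ[(A' ⁻¹' B).indicator (fun _ => (1 : ℝ)) | G])
    {𝒵 : Type*} [MeasurableSpace 𝒵] {Z : Ω → 𝒵} (hZ : Measurable[G] Z) {F : 𝒵 × 𝒜 → ℝ}
    (hF : Measurable F) : ∫ ω, F (Z ω, A ω) ∂μ = ∫ ω, F (Z ω, A' ω) ∂μ := by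
  have hZ' : Measurable Z := hZ.mono hG le_rfl
  rw [← integral_map (hZ'.prodMk hA).aemeasurable hF.aestronglyMeasurable,
    ← integral_map (hZ'.prodMk hA').aemeasurable hF.aestronglyMeasurable,
    map_prodMk_eq_of_condExp_indicator_eq hG hA hA' h hZ]

end Exchange

/-! ### From predictions to regret -/

section LinearBandit

open Matrix

variable {d : ℕ}

theorem Measurable.matrix_inv {Ω : Type*} {M : MeasurableSpace Ω}
    {V : Ω → Matrix (Fin d) (Fin d) ℝ} (hV : ∀ i j, Measurable fun ω => V ω i j) (i j : Fin d) :
    Measurable fun ω => (V ω)⁻¹ i j := by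
  have hV' : Measurable fun ω => (fun i j => V ω i j : Fin d → Fin d → ℝ) :=
    measurable_pi_iff.2 fun i => measurable_pi_iff.2 fun j => hV i j
  have hof : Continuous fun A : Fin d → Fin d → ℝ => Matrix.of A := continuous_id
  have h1 : Measurable fun ω => (V ω).det := hof.matrix_det.measurable.comp hV'
  have h2 : Measurable fun ω => (V ω).adjugate i j :=
    (hof.matrix_adjugate.matrix_elem i j).measurable.comp hV'
  have : (fun ω => (V ω)⁻¹ i j) = fun ω => (V ω).det⁻¹ * (V ω).adjugate i j := by
    ext ω
    rw [Matrix.inv_def, Ring.inverse_eq_inv', Matrix.smul_apply, smul_eq_mul]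
  rw [this]
  exact h1.inv.mul h2

theorem Measurable.of_symm_matrix_inv {Ω : Type*} {M : MeasurableSpace Ω}
    {V : Ω → Matrix (Fin d) (Fin d) ℝ} (hV : ∀ i j, Measurable fun ω => V ω i j) :
    Measurable fun ω => Matrix.of.symm (V ω)⁻¹ :=
  measurable_pi_iff.2 fun i => measurable_pi_iff.2 fun j => Measurable.matrix_inv hV i j

theorem Measurable.dotProduct' {Ω : Type*} {M : MeasurableSpace Ω} {u w : Ω → Fin d → ℝ}
    (hu : Measurable u) (hw : Measurable w) : Measurable fun ω => u ω ⬝ᵥ w ω :=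
  Finset.measurable_sum _ fun i _ =>
    ((measurable_pi_apply i).comp hu).mul ((measurable_pi_apply i).comp hw)

theorem measurable_regGram {Ω : Type*} {M : MeasurableSpace Ω} {v : ℕ → Ω → Fin d → ℝ} (r : ℝ)
    (n : ℕ) (hv : ∀ k < n, Measurable (v k)) (i j : Fin d) :
    Measurable fun ω => regGram r (fun k => v k ω) n i j := by
  simp only [regGram, Matrix.add_apply, Matrix.sum_apply, vecMulVec_apply]
  refine measurable_const.add (Finset.measurable_sum _ fun k hk => ?_)
  have h := hv k (Finset.mem_range.1 hk)
  exact ((measurable_pi_apply i).comp h).mul ((measurable_pi_apply j).comp h)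

theorem measurable_ridge {Ω : Type*} {M : MeasurableSpace Ω} {v : ℕ → Ω → Fin d → ℝ}
    {y : ℕ → Ω → ℝ} (r : ℝ) (n : ℕ) (hv : ∀ k < n, Measurable (v k))
    (hy : ∀ k < n, Measurable (y k)) :
    Measurable fun ω => ridge r (fun k => v k ω) (fun k => y k ω) n := by
  refine measurable_pi_iff.2 fun i => Measurable.dotProduct' (measurable_pi_iff.2 fun j => ?_)
    (Finset.measurable_sum _ fun k hk => ?_)
  · exact Measurable.matrix_inv (fun i j => measurable_regGram r n hv i j) i j
  · exact (hy k (Finset.mem_range.1 hk)).smul (hv k (Finset.mem_range.1 hk))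

theorem linearReward_eq_dotProduct {𝒜 : Type*} (φ : 𝒜 → EuclideanSpace ℝ (Fin d))
    (ρ : EuclideanSpace ℝ (Fin d)) (a : 𝒜) :
    linearReward φ ρ a = (φ a).ofLp ⬝ᵥ ρ.ofLp := by
  rw [linearReward, EuclideanSpace.inner_eq_star_dotProduct, star_trivial, dotProduct_comm]

theorem EuclideanSpace.dotProduct_self_eq_norm_sq (x : EuclideanSpace ℝ (Fin d)) :
    x.ofLp ⬝ᵥ x.ofLp = ‖x‖ ^ 2 := by
  rw [← real_inner_self_eq_norm_sq, EuclideanSpace.inner_eq_star_dotProduct, star_trivial]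

theorem abs_linearReward_le {𝒜 : Type*} {φ : 𝒜 → EuclideanSpace ℝ (Fin d)}
    {ρ : EuclideanSpace ℝ (Fin d)} {c₁ c₂ : ℝ} (hφ : ∀ a, ‖φ a‖ ≤ c₂) (hρ : ‖ρ‖ ≤ c₁) (a : 𝒜) :
    |linearReward φ ρ a| ≤ c₁ * c₂ := by
  rw [mul_comm]
  exact (abs_real_inner_le_norm _ _).trans (mul_le_mul (hφ a) hρ (norm_nonneg _)
    ((norm_nonneg _).trans (hφ a)))

variable {Ω : Type*} [mΩ : MeasurableSpace Ω] {μ : Measure Ω}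

theorem BanditProcess.measurable_action_history {P 𝒜 : Type*} [MeasurableSpace P]
    [MeasurableSpace 𝒜] (X : BanditProcess μ P 𝒜) {k t : ℕ} (h : k < t) :
    Measurable[X.history t] (X.action k) := by
  refine Measurable.mono (comap_measurable _) ?_ le_rfl
  exact le_sup_of_le_right (le_iSup₂_of_le k h le_sup_left)

theorem BanditProcess.measurable_reward_history {P 𝒜 : Type*} [MeasurableSpace P]
    [MeasurableSpace 𝒜] (X : BanditProcess μ P 𝒜) {k t : ℕ} (h : k < t) :
    Measurable[X.history t] (X.reward k) := by
  refine Measurable.mono (comap_measurable _) ?_ le_rfl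
  exact le_sup_of_le_right (le_iSup₂_of_le k h le_sup_right)

variable {𝒜 : Type*} [MeasurableSpace 𝒜] {σ c₁ c₂ : ℝ} {Θ : Set (EuclideanSpace ℝ (Fin d))}
  {φ : 𝒜 → EuclideanSpace ℝ (Fin d)} {X : BanditProcess μ (EuclideanSpace ℝ (Fin d)) 𝒜}

theorem BanditProcess.bayesRegret_eq_sum {P : Type*} [MeasurableSpace P] (Y : BanditProcess μ P 𝒜)
    (f : P → 𝒜 → ℝ) {Astar : ℕ → Ω → 𝒜}
    (h : ∀ t, ∀ᵐ ω ∂μ, Y.IsOptimalAction f t ω (Astar t ω)) (T : ℕ) :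
    Y.bayesRegret f T = ∑ t ∈ Finset.range T,
      ∫ ω, (f (Y.param ω) (Astar t ω) - f (Y.param ω) (Y.action t ω)) ∂μ := by
  refine Finset.sum_congr rfl fun t _ => integral_congr_ae ?_
  filter_upwards [h t] with ω hω
  have : IsGreatest (f (Y.param ω) '' Y.actionSet t ω) (f (Y.param ω) (Astar t ω)) :=
    ⟨Set.mem_image_of_mem _ hω.1, by rintro _ ⟨b, hb, rfl⟩; exact hω.2 b hb⟩
  rw [this.csSup_eq]

theorem IsLinearPosteriorSampling.norm_param_ae
    (h : IsLinearPosteriorSampling σ c₁ c₂ Θ φ X) : ∀ᵐ ω ∂μ, ‖X.param ω‖ ≤ c₁ :=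
  h.param_mem.mono fun _ hω => h.norm_param_le _ hω

theorem IsLinearPosteriorSampling.measurable_feature_ofLp
    (h : IsLinearPosteriorSampling σ c₁ c₂ Θ φ X) : Measurable fun a => (φ a).ofLp :=
  (PiLp.continuous_ofLp 2 _).measurable.comp h.measurable_feature

/-- The regret in one round in terms of the error of the ridge regression estimate for arbitrary
history-dependent responses `y`. -/
theorem IsLinearPosteriorSampling.integral_regret_le [IsProbabilityMeasure μ]
    (h : IsLinearPosteriorSampling σ c₁ c₂ Θ φ X) {r : ℝ} (hr : 0 < r) (hcr : c₂ ^ 2 ≤ r)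
    {y : ℕ → Ω → ℝ} {t : ℕ} (hy : ∀ k < t, Measurable[X.history t] (y k)) {B : ℝ}
    (hyB : ∀ k ω, |y k ω| ≤ B) {α : ℝ} (hα : 0 < α)
    {A' : Ω → 𝒜} (hA' : Measurable A')
    (hps : ∀ S : Set 𝒜, MeasurableSet S →
      μ[((X.action t) ⁻¹' S).indicator (fun _ => (1 : ℝ)) | X.history t] =ᵐ[μ]
        μ[(A' ⁻¹' S).indicator (fun _ => (1 : ℝ)) | X.history t]) :
    ∫ ω, (linearReward φ (X.param ω) (A' ω) - linearReward φ (X.param ω) (X.action t ω)) ∂μ ≤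
      α * ∫ ω, (φ (X.action t ω)).ofLp ⬝ᵥ
          (regGram r (fun k => (φ (X.action k ω)).ofLp) t)⁻¹ *ᵥ (φ (X.action t ω)).ofLp ∂μ +
        α⁻¹ * ∫ ω, (r * ‖X.param ω‖ ^ 2 + ∑ k ∈ Finset.range t,
          (linearReward φ (X.param ω) (X.action k ω) - y k ω) ^ 2) ∂μ := by
  have hφm := h.measurable_feature_ofLp
  have hHle := X.history_le t
  set v : ℕ → Ω → Fin d → ℝ := fun k ω => (φ (X.action k ω)).ofLp with hv
  have hvm : ∀ k < t, Measurable[X.history t] (v k) := fun k hk =>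
    hφm.comp (X.measurable_action_history hk)
  set Vi : Ω → Fin d → Fin d → ℝ := fun ω =>
    Matrix.of.symm (regGram r (fun k => v k ω) t)⁻¹ with hVi
  have hVim : Measurable[X.history t] Vi :=
    Measurable.of_symm_matrix_inv fun i j => measurable_regGram r t hvm i j
  set est : Ω → Fin d → ℝ := fun ω => ridge r (fun k => v k ω) (fun k => y k ω) t with hest
  have hestm : Measurable[X.history t] est := measurable_ridge r t hvm hy
  have hθm : Measurable fun ω => (X.param ω).ofLp :=
    (PiLp.continuous_ofLp 2 _).measurable.comp X.measurable_param
  set w : (Ω → 𝒜) → Ω → ℝ := fun A ω =>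
    (φ (A ω)).ofLp ⬝ᵥ (Matrix.of (Vi ω)) *ᵥ (φ (A ω)).ofLp with hw
  set Q : Ω → ℝ := fun ω => r * ‖X.param ω‖ ^ 2 + ∑ k ∈ Finset.range t,
          (linearReward φ (X.param ω) (X.action k ω) - y k ω) ^ 2 with hQ
  have hFm : Measurable fun z : (Fin d → Fin d → ℝ) × 𝒜 =>
      (φ z.2).ofLp ⬝ᵥ (Matrix.of z.1) *ᵥ (φ z.2).ofLp := by
    have h2 : Measurable fun z : (Fin d → Fin d → ℝ) × 𝒜 => (φ z.2).ofLp :=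
      hφm.comp measurable_snd
    refine Measurable.dotProduct' h2 (measurable_pi_iff.2 fun i => Measurable.dotProduct' ?_ h2)
    exact (measurable_pi_apply i).comp measurable_fst
  have hF'm : Measurable fun z : (Fin d → ℝ) × 𝒜 => (φ z.2).ofLp ⬝ᵥ z.1 :=
    Measurable.dotProduct' (hφm.comp measurable_snd) measurable_fst
  have hwm : ∀ {A : Ω → 𝒜}, Measurable A → Measurable (w A) := fun {A} hA =>
    hFm.comp ((hVim.mono hHle le_rfl).prodMk hA)
  have hem : ∀ {A : Ω → 𝒜}, Measurable A → Measurable fun ω => (φ (A ω)).ofLp ⬝ᵥ est ω :=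
    fun {A} hA => hF'm.comp ((hestm.mono hHle le_rfl).prodMk hA)
  have hlm : ∀ {A : Ω → 𝒜}, Measurable A → Measurable fun ω => linearReward φ (X.param ω) (A ω) := by
    intro A hA
    simp_rw [linearReward_eq_dotProduct]
    exact Measurable.dotProduct' (hφm.comp hA) hθm
  have hw0 : ∀ A ω, 0 ≤ w A ω := fun A ω =>
    dotProduct_inv_regGram_mulVec_nonneg hr (fun k => v k ω) t _
  have hw1 : ∀ A ω, w A ω ≤ 1 := fun A ω => by
    refine (dotProduct_inv_regGram_mulVec_le hr (fun k => v k ω) t _).trans ?_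
    rw [← div_eq_inv_mul, div_le_one hr, EuclideanSpace.dotProduct_self_eq_norm_sq]
    exact (pow_le_pow_left₀ (norm_nonneg _) (h.norm_feature_le _) 2).trans hcr
  have hwi : ∀ {A : Ω → 𝒜}, Measurable A → Integrable (w A) μ := fun {A} hA =>
    Integrable.of_bound (hwm hA).aestronglyMeasurable 1 (Filter.Eventually.of_forall fun ω => by
      rw [Real.norm_eq_abs, abs_of_nonneg (hw0 A ω)]; exact hw1 A ω)
  have hQ0 : ∀ ω, 0 ≤ Q ω := fun ω =>
    add_nonneg (mul_nonneg hr.le (sq_nonneg _)) (Finset.sum_nonneg fun k _ => sq_nonneg _)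
  have hQK : ∀ᵐ ω ∂μ, Q ω ≤ r * c₁ ^ 2 + ∑ _k ∈ Finset.range t, (c₁ * c₂ + B) ^ 2 := by
    filter_upwards [h.norm_param_ae] with ω hω
    refine add_le_add (mul_le_mul_of_nonneg_left (pow_le_pow_left₀ (norm_nonneg _) hω 2) hr.le)
      (Finset.sum_le_sum fun k _ => ?_)
    rw [← sq_abs]
    exact pow_le_pow_left₀ (abs_nonneg _) ((abs_sub _ _).trans
      (add_le_add (abs_linearReward_le h.norm_feature_le hω _) (hyB k ω))) 2
  set K := r * c₁ ^ 2 + ∑ _k ∈ Finset.range t, (c₁ * c₂ + B) ^ 2 with hK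
  have hQm : Measurable Q := by
    refine ((X.measurable_param.norm.pow_const 2).const_mul r).add
      (Finset.measurable_sum _ fun k hk => ?_)
    exact ((hlm (X.measurable_action k)).sub
      ((hy k (Finset.mem_range.1 hk)).mono hHle le_rfl)).pow_const 2
  have hQi : Integrable Q μ := Integrable.of_bound hQm.aestronglyMeasurable K (by
    filter_upwards [hQK] with ω hω
    rwa [Real.norm_eq_abs, abs_of_nonneg (hQ0 ω)])
  have hli : ∀ {A : Ω → 𝒜}, Measurable A →
      Integrable (fun ω => linearReward φ (X.param ω) (A ω)) μ := fun {A} hA =>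
    Integrable.of_bound (hlm hA).aestronglyMeasurable (c₁ * c₂) (by
      filter_upwards [h.norm_param_ae] with ω hω
      exact abs_linearReward_le h.norm_feature_le hω _)
  -- The sign `s` is 1 for the optimal action and -1 for the played one.
  have hyoung : ∀ A ω (s : ℝ), s ^ 2 = 1 → ∀ a : ℝ, 0 < a →
      2 * (s * (linearReward φ (X.param ω) (A ω) - (φ (A ω)).ofLp ⬝ᵥ est ω)) ≤
        a * w A ω + a⁻¹ * Q ω := by
    intro A ω s hs a ha
    have h1 := two_mul_dotProduct_le_regGram hr (fun k => v k ω) t (φ (A ω)).ofLp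
      (s • ((X.param ω).ofLp - est ω)) ha
    have h2 := ridge_error_le hr (fun k => v k ω) (fun k => y k ω) t (X.param ω).ofLp
    rw [EuclideanSpace.dotProduct_self_eq_norm_sq] at h2
    simp only [hv, ← linearReward_eq_dotProduct] at h2
    rw [dotProduct_smul, dotProduct_sub, mulVec_smul, smul_dotProduct, dotProduct_smul,
      ← linearReward_eq_dotProduct] at h1
    simp only [smul_eq_mul] at h1
    rw [← mul_assoc s s, ← sq, hs, one_mul] at h1
    exact h1.trans (add_le_add_right (mul_le_mul_of_nonneg_left h2 (inv_nonneg.2 ha.le)) _)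
  -- The estimated reward is bounded because it differs from the bounded true reward by at most half
  -- of width plus error, by `hyoung` with both signs and `a = 1`.
  have hei : ∀ {A : Ω → 𝒜}, Measurable A → Integrable (fun ω => (φ (A ω)).ofLp ⬝ᵥ est ω) μ :=
    fun {A} hA => Integrable.of_bound (hem hA).aestronglyMeasurable (c₁ * c₂ + (1 + K) / 2) (by
      filter_upwards [h.norm_param_ae, hQK] with ω hω hω'
      have h1 := hyoung A ω 1 (by norm_num) 1 one_pos
      have h2 := hyoung A ω (-1) (by norm_num) 1 one_pos
      have h3 := abs_le.1 (abs_linearReward_le h.norm_feature_le hω (A ω))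
      have h4 := hw1 A ω
      rw [inv_one] at h1 h2
      exact abs_le.2 ⟨by linarith, by linarith⟩)
  have hA := X.measurable_action t
  -- The only use of posterior sampling: `Vi` and `est` are history-measurable, so `A'` may replace
  -- the played action.
  have hex1 : ∫ ω, w (X.action t) ω ∂μ = ∫ ω, w A' ω ∂μ :=
    integral_comp_eq_of_condExp_indicator_eq hHle hA hA' hps hVim hFm
  have hex2 : ∫ ω, (φ (X.action t ω)).ofLp ⬝ᵥ est ω ∂μ = ∫ ω, (φ (A' ω)).ofLp ⬝ᵥ est ω ∂μ :=
    integral_comp_eq_of_condExp_indicator_eq hHle hA hA' hps hestm hF'm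
  have hbound : ∀ {A : Ω → 𝒜}, Measurable A → ∀ s : ℝ, s ^ 2 = 1 →
      s * (∫ ω, linearReward φ (X.param ω) (A ω) ∂μ - ∫ ω, (φ (A ω)).ofLp ⬝ᵥ est ω ∂μ) ≤
        (α * ∫ ω, w A ω ∂μ + α⁻¹ * ∫ ω, Q ω ∂μ) / 2 := by
    intro A hA s hs
    rw [← integral_sub (hli hA) (hei hA), ← integral_const_mul, ← integral_const_mul,
      ← integral_const_mul, ← integral_add ((hwi hA).const_mul α) (hQi.const_mul α⁻¹),
      ← integral_div]
    refine integral_mono (((hli hA).sub (hei hA)).const_mul s)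
      ((((hwi hA).const_mul α).add (hQi.const_mul α⁻¹)).div_const 2) fun ω => ?_
    have := hyoung A ω s hs α hα
    dsimp only
    linarith
  have hb1 := hbound hA' 1 (by norm_num)
  have hb2 := hbound hA (-1) (by norm_num)
  rw [integral_sub (hli hA') (hli hA)]
  change _ ≤ α * ∫ ω, w (X.action t) ω ∂μ + α⁻¹ * ∫ ω, Q ω ∂μ
  rw [← hex1, ← hex2] at hb1
  linarith

/-- The Bayesian regret in terms of the error of history-dependent predictions `y` of the mean
rewards. -/
theorem IsLinearPosteriorSampling.bayesRegret_le_of_prediction [IsProbabilityMeasure μ]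
    (h : IsLinearPosteriorSampling σ c₁ c₂ Θ φ X) (hc₂ : 0 < c₂)
    {y : ℕ → Ω → ℝ} (hy : ∀ t, ∀ k < t, Measurable[X.history t] (y k)) {B : ℝ}
    (hyB : ∀ k ω, |y k ω| ≤ B) {α β : ℝ} (hα : 0 < α) {T : ℕ} (hT : 0 < T)
    (hβ : ∀ t < T, ∫ ω, (c₂ ^ 2 * ‖X.param ω‖ ^ 2 + ∑ k ∈ Finset.range t,
          (linearReward φ (X.param ω) (X.action k ω) - y k ω) ^ 2) ∂μ ≤ β) :
    X.bayesRegret (linearReward φ) T ≤ α * (2 * d * Real.log (d + T)) + α⁻¹ * (T * β) := by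
  obtain ⟨A', hA'm, hA'opt, hA'ps⟩ := h.posteriorSampling
  -- The regularization is `c₂ ^ 2`, which keeps all widths at most 1.
  have hr : 0 < c₂ ^ 2 := by positivity
  rw [X.bayesRegret_eq_sum _ hA'opt]
  set w : ℕ → Ω → ℝ := fun t ω => (φ (X.action t ω)).ofLp ⬝ᵥ
    (regGram (c₂ ^ 2) (fun k => (φ (X.action k ω)).ofLp) t)⁻¹ *ᵥ (φ (X.action t ω)).ofLp with hw
  have hv : ∀ ω k, (φ (X.action k ω)).ofLp ⬝ᵥ (φ (X.action k ω)).ofLp ≤ c₂ ^ 2 := fun ω k => by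
    rw [EuclideanSpace.dotProduct_self_eq_norm_sq]
    exact pow_le_pow_left₀ (norm_nonneg _) (h.norm_feature_le _) 2
  have hvm : ∀ k, Measurable fun ω => (φ (X.action k ω)).ofLp := fun k =>
    h.measurable_feature_ofLp.comp (X.measurable_action k)
  have hwm : ∀ t, Measurable (w t) := fun t =>
    Measurable.dotProduct' (hvm t) (measurable_pi_iff.2 fun i => Measurable.dotProduct'
      (measurable_pi_iff.2 fun j => Measurable.matrix_inv
        (fun i j => measurable_regGram _ t (fun k _ => hvm k) i j) i j) (hvm t))
  have hwi : ∀ t, Integrable (w t) μ := fun t => by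
    refine Integrable.of_bound (hwm t).aestronglyMeasurable 1 (Filter.Eventually.of_forall fun ω => ?_)
    rw [Real.norm_eq_abs, abs_of_nonneg (dotProduct_inv_regGram_mulVec_nonneg hr _ t _)]
    refine (dotProduct_inv_regGram_mulVec_le hr _ t _).trans ?_
    rw [← div_eq_inv_mul, div_le_one hr]
    exact hv ω t
  calc _ ≤ ∑ t ∈ Finset.range T, (α * ∫ ω, w t ω ∂μ + α⁻¹ * β) := by
        refine Finset.sum_le_sum fun t ht => ?_
        refine (h.integral_regret_le hr le_rfl (hy t) hyB hα (hA'm t) (hA'ps t)).trans ?_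
        exact add_le_add_right (mul_le_mul_of_nonneg_left (hβ t (Finset.mem_range.1 ht))
          (inv_nonneg.2 hα.le)) _
    _ = α * ∫ ω, ∑ t ∈ Finset.range T, w t ω ∂μ + α⁻¹ * (T * β) := by
        rw [Finset.sum_add_distrib, ← Finset.mul_sum, integral_finsetSum _ fun t _ => hwi t]
        simp
        ring
    _ ≤ _ := by
        refine add_le_add_left (mul_le_mul_of_nonneg_left ?_ hα.le) _
        have := integral_mono (integrable_finsetSum _ fun t _ => hwi t)
          (integrable_const (2 * d * Real.log (d + T))) (μ := μ) fun ω =>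
          sum_dotProduct_inv_regGram_le hr (fun k => (φ (X.action k ω)).ofLp) (hv ω) T hT
        simpa using this

end LinearBandit

/-! ### The number of nonzero components -/

section ZeroNorm

variable {d : ℕ}

theorem zeroNorm_eq_sum (v : EuclideanSpace ℝ (Fin d)) :
    (zeroNorm v : ℝ) = ∑ i, if v i = 0 then (0 : ℝ) else 1 := by
  have h : {i : Fin d | v i ≠ 0} = ↑(Finset.univ.filter fun i => v i ≠ 0) := by ext; simp
  rw [zeroNorm, h, Set.ncard_coe_finset, Finset.card_filter]
  push_cast
  exact Finset.sum_congr rfl fun i _ => by by_cases hi : v i = 0 <;> simp [hi]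

theorem zeroNorm_le (v : EuclideanSpace ℝ (Fin d)) : (zeroNorm v : ℝ) ≤ d := by
  rw [zeroNorm_eq_sum]
  calc _ ≤ ∑ _i : Fin d, (1 : ℝ) := Finset.sum_le_sum fun i _ => by split_ifs <;> norm_num
    _ = d := by simp

theorem one_le_zeroNorm {v : EuclideanSpace ℝ (Fin d)} (hv : v ≠ 0) : (1 : ℝ) ≤ zeroNorm v := by
  have : zeroNorm v ≠ 0 := by
    intro h
    rw [zeroNorm, Set.ncard_eq_zero (Set.toFinite _)] at h
    refine hv (PiLp.ext fun i => ?_)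
    by_contra hi
    exact (h ▸ (show i ∈ {i : Fin d | v i ≠ 0} from hi) : i ∈ (∅ : Set (Fin d)))
  exact_mod_cast Nat.one_le_iff_ne_zero.2 this

theorem measurable_zeroNorm :
    Measurable fun v : EuclideanSpace ℝ (Fin d) => (zeroNorm v : ℝ) := by
  simp_rw [zeroNorm_eq_sum]
  refine Finset.measurable_sum _ fun i _ => Measurable.ite ?_ measurable_const measurable_const
  have : Measurable fun v : EuclideanSpace ℝ (Fin d) => v i := by fun_prop
  exact this (measurableSet_singleton 0)

theorem integrable_zeroNorm {Ω : Type*} [MeasurableSpace Ω] {μ : Measure Ω} [IsFiniteMeasure μ]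
    {θ : Ω → EuclideanSpace ℝ (Fin d)} (hθ : Measurable θ) :
    Integrable (fun ω => (zeroNorm (θ ω) : ℝ)) μ :=
  Integrable.of_bound (measurable_zeroNorm.comp hθ).aestronglyMeasurable d
    (Filter.Eventually.of_forall fun ω => by
      rw [Real.norm_eq_abs, abs_of_nonneg (Nat.cast_nonneg _)]; exact zeroNorm_le _)

end ZeroNorm

/-! ### The grid of experts and its sparse prior -/

section Net

/-- The integers of absolute value at most `N`. -/
abbrev BoundedInt (N : ℕ) : Type := {z : ℤ // z ∈ Finset.Icc (-(N : ℤ)) N}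

/-- Rounding to a multiple of `1 / M`, truncated at `N / M` in absolute value. -/
noncomputable def roundBounded (N : ℕ) (M x : ℝ) : BoundedInt N :=
  ⟨max (-(N : ℤ)) (min N ⌊x * M⌋), by
    have : -(N : ℤ) ≤ N := by omega
    simp [this]⟩

theorem measurable_roundBounded (N : ℕ) (M : ℝ) : Measurable (roundBounded N M) := by
  refine Measurable.subtype_mk ?_
  exact (measurable_of_countable fun z : ℤ => max (-(N : ℤ)) (min N z)).comp
    (Int.measurable_floor.comp (measurable_id.mul_const M))

/-- Rounding therefore creates no new nonzero components. -/
theorem roundBounded_zero (N : ℕ) (M : ℝ) : (roundBounded N M 0 : ℤ) = 0 := by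
  simp [roundBounded]

theorem abs_sub_roundBounded_le {N : ℕ} {M c x : ℝ} (hM : 0 < M) (hx : |x| ≤ c)
    (hN : c * M + 1 ≤ N) : |x - (roundBounded N M x : ℤ) / M| ≤ 1 / M := by
  obtain ⟨h1, h2⟩ := abs_le.1 hx
  have h3 := Int.floor_le (x * M)
  have h4 := Int.lt_floor_add_one (x * M)
  have h5 : (⌊x * M⌋ : ℤ) ≤ N := by
    have : (⌊x * M⌋ : ℝ) ≤ N := by nlinarith
    exact_mod_cast this
  have h6 : -(N : ℤ) ≤ ⌊x * M⌋ := by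
    have : -(N : ℝ) ≤ ⌊x * M⌋ := by nlinarith
    exact_mod_cast this
  have h7 : (roundBounded N M x : ℤ) = ⌊x * M⌋ := by
    change max (-(N : ℤ)) (min N ⌊x * M⌋) = _
    rw [min_eq_right h5, max_eq_right h6]
  rw [h7, show x - (⌊x * M⌋ : ℝ) / M = (x * M - ⌊x * M⌋) / M by field_simp, abs_div, abs_of_pos hM]
  exact div_le_div_of_nonneg_right (abs_le.2 ⟨by linarith, by linarith⟩) hM.le

/-- A product weight on integer vectors that favours sparse vectors. -/
noncomputable def sparseWeight {d : ℕ} {N : ℕ} (τ : ℝ) (i : Fin d → BoundedInt N) : ℝ :=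
  ∏ j, if (i j : ℤ) = 0 then 1 else τ

theorem sparseWeight_pos {d N : ℕ} {τ : ℝ} (hτ : 0 < τ) (i : Fin d → BoundedInt N) :
    0 < sparseWeight τ i :=
  Finset.prod_pos fun j _ => by split_ifs <;> [exact one_pos; exact hτ]

/-- The sum factorizes over coordinates into `(1 + 2 * N * τ) ^ d`: one zero entry and `2 * N`
nonzero ones. -/
theorem log_sum_sparseWeight_le {d N : ℕ} {τ : ℝ} (hτ : 0 < τ) :
    Real.log (∑ i : Fin d → BoundedInt N, sparseWeight τ i) ≤ d * (2 * N * τ) := by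
  have h1 : ∑ z : BoundedInt N, (if (z : ℤ) = 0 then (1 : ℝ) else τ) = 1 + 2 * N * τ := by
    rw [Finset.univ_eq_attach,
      Finset.sum_attach (Finset.Icc (-(N : ℤ)) N) fun z => if z = 0 then (1 : ℝ) else τ,
      ← Finset.add_sum_erase _ _ (show (0 : ℤ) ∈ Finset.Icc (-(N : ℤ)) N by simp)]
    rw [Finset.sum_congr rfl fun z hz => if_neg (Finset.ne_of_mem_erase hz)]
    have hcard : ((Finset.Icc (-(N : ℤ)) N).erase 0).card = 2 * N := by
      rw [Finset.card_erase_of_mem (by simp), Int.card_Icc]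
      omega
    rw [Finset.sum_const, hcard]
    simp
  have h2 : ∑ i : Fin d → BoundedInt N, sparseWeight τ i = (1 + 2 * N * τ) ^ d := by
    have := Finset.prod_univ_sum (fun _ : Fin d => (Finset.univ : Finset (BoundedInt N)))
      fun _ z => if (z : ℤ) = 0 then (1 : ℝ) else τ
    rw [Fintype.piFinset_univ] at this
    simp only [sparseWeight]
    rw [← this, h1]
    simp
  have h3 : 0 < 1 + 2 * N * τ := by positivity
  rw [h2, Real.log_pow]
  have := Real.log_le_sub_one_of_pos h3
  exact mul_le_mul_of_nonneg_left (by linarith) (Nat.cast_nonneg d)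

/-- Only coordinates in the support of `v` can pay -log `τ`; this is where sparsity enters the
regret. -/
theorem neg_log_sparseWeight_round_le {d N : ℕ} {τ : ℝ} (hτ : 0 < τ) (hτ1 : τ ≤ 1) (M : ℝ)
    (v : EuclideanSpace ℝ (Fin d)) :
    -Real.log (sparseWeight τ fun j => roundBounded N M (v j)) ≤ zeroNorm v * -Real.log τ := by
  have hlog : Real.log τ ≤ 0 := Real.log_nonpos hτ.le hτ1
  rw [sparseWeight, Real.log_prod fun j _ => by split_ifs <;> [exact one_ne_zero; exact hτ.ne'],
    zeroNorm_eq_sum, Finset.sum_mul, ← Finset.sum_neg_distrib]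
  refine Finset.sum_le_sum fun j _ => ?_
  by_cases hj : v j = 0
  · rw [hj, if_pos (roundBounded_zero N M)]
    simp
  · rw [if_neg hj, one_mul]
    split_ifs
    · simpa using hlog
    · exact le_rfl

theorem norm_sub_round_le {d N : ℕ} {M c : ℝ} (hM : 0 < M) (hN : c * M + 1 ≤ N)
    {v : EuclideanSpace ℝ (Fin d)} (hv : ‖v‖ ≤ c) :
    ‖v - WithLp.toLp 2 fun j => ((roundBounded N M (v j) : ℤ) : ℝ) / M‖ ^ 2 ≤ d / M ^ 2 := by
  rw [EuclideanSpace.norm_sq_eq]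
  calc _ ≤ ∑ _j : Fin d, (1 / M) ^ 2 := by
        refine Finset.sum_le_sum fun j _ => pow_le_pow_left₀ (norm_nonneg _) ?_ 2
        exact abs_sub_roundBounded_le hM ((PiLp.norm_apply_le v j).trans hv) hN
    _ = d / M ^ 2 := by simp [div_eq_mul_inv]

/-- Truncation to the interval `[-B, B]`. -/
def truncate (B x : ℝ) : ℝ := max (-B) (min B x)

theorem abs_truncate_le {B : ℝ} (hB : 0 ≤ B) (x : ℝ) : |truncate B x| ≤ B :=
  abs_le.2 ⟨le_max_left _ _, max_le (by linarith) (min_le_left _ _)⟩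

theorem truncate_of_abs_le {B x : ℝ} (hx : |x| ≤ B) : truncate B x = x := by
  rw [truncate, min_eq_right (abs_le.1 hx).2, max_eq_right (abs_le.1 hx).1]

theorem abs_truncate_sub_truncate_le (B x y : ℝ) : |truncate B x - truncate B y| ≤ |x - y| := by
  have h1 := abs_max_sub_max_le_max (-B) (min B x) (-B) (min B y)
  have h2 := abs_min_sub_min_le_max B x B y
  simp only [sub_self, abs_zero, abs_nonneg, max_eq_right] at h1 h2
  exact h1.trans h2

theorem measurable_truncate (B : ℝ) : Measurable (truncate B) :=
  measurable_const.max (measurable_const.min measurable_id)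

end Net

/-! ### The regret bound in terms of the expected sparsity -/

section Regret

variable {d : ℕ} {Ω : Type*} [mΩ : MeasurableSpace Ω] {μ : Measure Ω}
  {𝒜 : Type*} [MeasurableSpace 𝒜] {σ c₁ c₂ : ℝ} {Θ : Set (EuclideanSpace ℝ (Fin d))}
  {φ : 𝒜 → EuclideanSpace ℝ (Fin d)} {X : BanditProcess μ (EuclideanSpace ℝ (Fin d)) 𝒜}

theorem measurable_linearReward {Ω' : Type*} {M : MeasurableSpace Ω'} (hφ : Measurable φ)
    {θ : Ω' → EuclideanSpace ℝ (Fin d)} (hθ : Measurable θ) {A : Ω' → 𝒜} (hA : Measurable A) :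
    Measurable fun ω => linearReward φ (θ ω) (A ω) :=
  (hφ.comp hA).inner hθ

theorem BanditProcess.measurable_param_historyActionParam {P : Type*} [MeasurableSpace P]
    (Y : BanditProcess μ P 𝒜) (t : ℕ) : Measurable[Y.historyActionParam t] Y.param :=
  Measurable.mono (comap_measurable _) le_sup_right le_rfl

theorem BanditProcess.measurable_action_historyActionParam {P : Type*} [MeasurableSpace P]
    (Y : BanditProcess μ P 𝒜) {k t : ℕ} (h : k ≤ t) :
    Measurable[Y.historyActionParam t] (Y.action k) := by
  rcases h.lt_or_eq with h | rfl
  · exact (Y.measurable_action_history h).mono (le_sup_of_le_left le_sup_left) le_rfl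
  · exact Measurable.mono (comap_measurable _) (le_sup_of_le_left le_sup_right) le_rfl

/-- History-dependent predictions of the mean rewards whose expected cumulative squared error is
of the order of the expected sparsity of the parameter. -/
theorem IsLinearPosteriorSampling.exists_prediction [IsProbabilityMeasure μ]
    (h : IsLinearPosteriorSampling σ c₁ c₂ Θ φ X) (hσ : 0 < σ) (hc₁ : 0 < c₁) (hc₂ : 0 < c₂)
    {T : ℕ} (hd : 0 < d) (hdT : d ≤ T) :
    ∃ y : ℕ → Ω → ℝ, (∀ t, ∀ k < t, Measurable[X.history t] (y k)) ∧
      (∀ k ω, |y k ω| ≤ c₁ * c₂) ∧ ∀ n ≤ T,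
      1 / (4 * σ ^ 2) / 2 / (1 + 2 * (1 / (4 * σ ^ 2)) * (c₁ * c₂) ^ 2) *
        ∫ ω, ∑ k ∈ Finset.range n,
          (linearReward φ (X.param ω) (X.action k ω) - y k ω) ^ 2 ∂μ ≤
      (∫ ω, (zeroNorm (X.param ω) : ℝ) ∂μ) * Real.log (2 * (c₁ + 2) * T ^ 4) +
        (1 + 1 / (4 * σ ^ 2) * c₂ ^ 2) / T := by
  have hT : 0 < T := hd.trans_le hdT
  have hT0 : (0 : ℝ) < T := by exact_mod_cast hT
  have hT1 : (1 : ℝ) ≤ T := by exact_mod_cast hT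
  have hd0 : (0 : ℝ) < d := by exact_mod_cast hd
  have hd1 : (1 : ℝ) ≤ d := by exact_mod_cast hd
  have hdT' : (d : ℝ) ≤ T := by exact_mod_cast hdT
  set B := c₁ * c₂ with hB
  have hB0 : 0 ≤ B := by positivity
  -- With this mesh the squared rounding error is at most d/T⁴ ≤ 1/T², so the accumulated squared
  -- bias over `T` rounds is at most `c₂ ^ 2 / T`.
  set M : ℝ := (T : ℝ) ^ 2 with hM
  have hM0 : 0 < M := by positivity
  have hM1 : 1 ≤ M := one_le_pow₀ hT1
  set N : ℕ := ⌈c₁ * M⌉₊ + 1 with hN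
  have hN1 : (1 : ℝ) ≤ N := by rw [hN]; push_cast; linarith [Nat.cast_nonneg (α := ℝ) ⌈c₁ * M⌉₊]
  have hNM : c₁ * M + 1 ≤ N := by rw [hN]; push_cast; linarith [Nat.le_ceil (c₁ * M)]
  have hNle : (N : ℝ) ≤ (c₁ + 2) * M := by
    rw [hN]
    push_cast
    linarith [Nat.ceil_lt_add_one (show 0 ≤ c₁ * M by positivity)]
  -- Chosen so that the log of the total prior mass is at most `1 / T`, while -log `τ` is still of
  -- order log `T`.
  set τ : ℝ := 1 / (2 * N * d * T) with hτ
  have hden : 1 ≤ 2 * N * d * (T : ℝ) := by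
    have : 1 ≤ (N : ℝ) * d * T := one_le_mul_of_one_le_of_one_le
      (one_le_mul_of_one_le_of_one_le hN1 hd1) hT1
    linarith
  have hτ0 : 0 < τ := by positivity
  have hτ1 : τ ≤ 1 := by rw [hτ, div_le_one (by linarith)]; exact hden
  have hτlog : -Real.log τ ≤ Real.log (2 * (c₁ + 2) * T ^ 4) := by
    rw [hτ, one_div, Real.log_inv, neg_neg]
    refine Real.log_le_log (by linarith) ?_
    calc 2 * N * d * (T : ℝ) ≤ 2 * ((c₁ + 2) * M) * T * T := by gcongr
      _ = _ := by rw [hM]; ring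
  set pt : (Fin d → BoundedInt N) → EuclideanSpace ℝ (Fin d) := fun i =>
    WithLp.toLp 2 fun j => ((i j : ℤ) : ℝ) / M with hpt
  -- Grid points may have norm above `c₁`, and `X.param` obeys its bound only almost surely;
  -- truncation makes experts and means bounded everywhere.
  set g : (Fin d → BoundedInt N) → ℕ → Ω → ℝ := fun i k ω =>
    truncate B (linearReward φ (pt i) (X.action k ω)) with hg
  set m : ℕ → Ω → ℝ := fun k ω => truncate B (linearReward φ (X.param ω) (X.action k ω)) with hm
  set J : Ω → Fin d → BoundedInt N := fun ω j => roundBounded N M (X.param ω j) with hJ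
  have hφm := h.measurable_feature
  have hgm : ∀ {M : MeasurableSpace Ω} i {A : Ω → 𝒜}, Measurable[M] A →
      Measurable[M] fun ω => truncate B (linearReward φ (pt i) (A ω)) :=
    fun i A hA => (measurable_truncate B).comp
      (measurable_linearReward hφm measurable_const hA)
  have hmean : ∀ᵐ ω ∂μ, ∀ k, m k ω = linearReward φ (X.param ω) (X.action k ω) := by
    filter_upwards [h.norm_param_ae] with ω hω k
    exact truncate_of_abs_le (abs_linearReward_le h.norm_feature_le hω _)
  have hJm : ∀ n i, MeasurableSet[X.historyActionParam n] (J ⁻¹' {i}) := by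
    intro n i
    have h1 : Measurable fun v : EuclideanSpace ℝ (Fin d) => fun j => roundBounded N M (v j) :=
      measurable_pi_iff.2 fun j => (measurable_roundBounded N M).comp (by fun_prop)
    exact (h1.comp (X.measurable_param_historyActionParam n)) (measurableSet_singleton i)
  have hJδ : ∀ᵐ ω ∂μ, ∀ n, |m n ω - g (J ω) n ω| ≤ c₂ / T := by
    filter_upwards [h.norm_param_ae] with ω hω n
    refine (abs_truncate_sub_truncate_le B _ _).trans ?_
    rw [linearReward, linearReward, ← inner_sub_right]
    refine (abs_real_inner_le_norm _ _).trans ?_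
    have h1 : ‖X.param ω - pt (J ω)‖ ^ 2 ≤ d / M ^ 2 := norm_sub_round_le hM0 hNM hω
    have h2 : (d : ℝ) / M ^ 2 ≤ (1 / T) ^ 2 := by
      rw [hM, div_pow, div_le_div_iff₀ (by positivity) (by positivity)]
      have : (T : ℝ) ^ 3 ≤ T ^ 4 := pow_le_pow_right₀ hT1 (by norm_num)
      nlinarith [mul_le_mul_of_nonneg_right hdT' (sq_nonneg (T : ℝ))]
    have h3 : ‖X.param ω - pt (J ω)‖ ≤ 1 / T :=
      le_of_sq_le_sq (h1.trans h2) (by positivity)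
    calc _ ≤ c₂ * (1 / T) := mul_le_mul (h.norm_feature_le _) h3 (norm_nonneg _) hc₂.le
      _ = c₂ / T := by ring
  have : Nonempty (Fin d → BoundedInt N) := ⟨fun _ => roundBounded N M 0⟩
  -- The forecast for round `k` uses the actions up to `k` and the rewards before `k`, all known to
  -- the history of every later round.
  refine ⟨fun k ω => expForecast (1 / (4 * σ ^ 2)) (sparseWeight τ) (fun i k => g i k ω)
    (fun k => X.reward k ω) k, fun t k hk => ?_, fun k ω => ?_, fun n hn => ?_⟩
  · exact measurable_expForecast (M := X.history t)
      (fun i l hl => hgm i (X.measurable_action_history (hl.trans_lt hk)))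
      fun l hl => X.measurable_reward_history (hl.trans hk)
  · exact abs_expForecast_le (sparseWeight_pos hτ0) _ k fun i => abs_truncate_le hB0 _
  -- The analysis uses the larger σ-algebras containing the parameter, for which the means `m` and
  -- the comparator `J` are measurable.
  · have key := integral_sum_sq_sub_expForecast_le (μ := μ) (G := X.historyActionParam)
      X.historyActionParam_le hσ rfl (sparseWeight_pos (N := N) hτ0) (y := X.reward) (m := m) (g := g)
      (B := B)
      (fun n k hk => (X.measurable_reward_history hk).mono (le_sup_of_le_left le_sup_left) le_rfl)
      X.measurable_reward
      (fun n => (measurable_truncate B).comp (measurable_linearReward h.measurable_feature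
        (X.measurable_param_historyActionParam n) (X.measurable_action_historyActionParam le_rfl)))
      (fun n i k hk => hgm i (X.measurable_action_historyActionParam hk))
      (fun n ω => abs_truncate_le hB0 _) (fun i n ω => abs_truncate_le hB0 _)
      (fun n => (h.noise n).congr (by
        filter_upwards [hmean] with ω hω
        rw [hω n]))
      hJm hJδ n
    have hcongr : ∫ ω, ∑ k ∈ Finset.range n, (m k ω - expForecast (1 / (4 * σ ^ 2))
          (sparseWeight τ) (fun i k => g i k ω) (fun k => X.reward k ω) k) ^ 2 ∂μ =
        ∫ ω, ∑ k ∈ Finset.range n, (linearReward φ (X.param ω) (X.action k ω) -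
          expForecast (1 / (4 * σ ^ 2)) (sparseWeight τ) (fun i k => g i k ω)
          (fun k => X.reward k ω) k) ^ 2 ∂μ := by
      refine integral_congr_ae ?_
      filter_upwards [hmean] with ω hω
      exact Finset.sum_congr rfl fun k _ => by rw [hω k]
    rw [hcongr] at key
    refine key.trans ?_
    have h0 := integrable_zeroNorm (μ := μ) X.measurable_param
    have h1 : ∫ ω, (Real.log (∑ i : Fin d → BoundedInt N, sparseWeight τ i) -
        Real.log (sparseWeight τ (J ω))) ∂μ ≤
        ∫ ω, (1 / T + zeroNorm (X.param ω) * Real.log (2 * (c₁ + 2) * T ^ 4)) ∂μ := by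
      have hbd : ∀ ω, Real.log (∑ i : Fin d → BoundedInt N, sparseWeight τ i) -
          Real.log (sparseWeight τ (J ω)) ≤
          1 / T + zeroNorm (X.param ω) * Real.log (2 * (c₁ + 2) * T ^ 4) := by
        intro ω
        have h2 := log_sum_sparseWeight_le (d := d) (N := N) hτ0
        have h3 := neg_log_sparseWeight_round_le (N := N) hτ0 hτ1 M (X.param ω)
        have h4 := mul_le_mul_of_nonneg_left hτlog (Nat.cast_nonneg (α := ℝ) (zeroNorm (X.param ω)))
        have h5 : d * (2 * N * τ) = 1 / (T : ℝ) := by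
          rw [hτ]
          field_simp
        change _ - Real.log (sparseWeight τ fun j => roundBounded N M (X.param ω j)) ≤ _
        linarith
      refine integral_mono ?_ ((integrable_const _).add (h0.mul_const _)) hbd
      have hJm' : Measurable J := measurable_pi_iff.2 fun j =>
        (measurable_roundBounded N M).comp
          ((show Measurable fun v : EuclideanSpace ℝ (Fin d) => v j by fun_prop).comp
            X.measurable_param)
      refine Integrable.of_bound (Measurable.aestronglyMeasurable (measurable_const.sub
        ((measurable_of_countable fun i => Real.log (sparseWeight τ i)).comp hJm')))
        (∑ i : Fin d → BoundedInt N, |Real.log (∑ i : Fin d → BoundedInt N, sparseWeight τ i) -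
          Real.log (sparseWeight τ i)|) (Filter.Eventually.of_forall fun ω => ?_)
      exact Finset.single_le_sum
        (f := fun i => |Real.log (∑ i : Fin d → BoundedInt N, sparseWeight τ i) -
          Real.log (sparseWeight τ i)|) (fun i _ => abs_nonneg _)
        (Finset.mem_univ (J ω))
    rw [integral_add (integrable_const _) (h0.mul_const _), integral_mul_const] at h1
    simp only [integral_const, probReal_univ, smul_eq_mul, one_mul] at h1
    have h6 : (n : ℝ) * (c₂ / T) ^ 2 ≤ c₂ ^ 2 / T := by
      have : (n : ℝ) ≤ T := by exact_mod_cast hn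
      calc (n : ℝ) * (c₂ / T) ^ 2 ≤ T * (c₂ / T) ^ 2 := by gcongr
        _ = c₂ ^ 2 / T := by field_simp
    have h7 : 1 / (4 * σ ^ 2) * ((n : ℝ) * (c₂ / T) ^ 2) ≤ 1 / (4 * σ ^ 2) * (c₂ ^ 2 / T) := by
      gcongr
    have h8 : (1 + 1 / (4 * σ ^ 2) * c₂ ^ 2) / (T : ℝ) =
        1 / T + 1 / (4 * σ ^ 2) * (c₂ ^ 2 / T) := by ring
    rw [h8]
    linarith

/-- The trivial regret bound: there is no regret when the parameter vanishes. -/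
theorem IsLinearPosteriorSampling.bayesRegret_le_trivial [IsProbabilityMeasure μ]
    (h : IsLinearPosteriorSampling σ c₁ c₂ Θ φ X) (hc₁ : 0 < c₁) (hc₂ : 0 < c₂) (T : ℕ) :
    X.bayesRegret (linearReward φ) T ≤
      2 * (c₁ * c₂) * (T * min 1 (∫ ω, (zeroNorm (X.param ω) : ℝ) ∂μ)) := by
  obtain ⟨A', hA'm, hA'opt, -⟩ := h.posteriorSampling
  rw [X.bayesRegret_eq_sum _ hA'opt]
  have h0 := integrable_zeroNorm (μ := μ) X.measurable_param
  set S := ∫ ω, (zeroNorm (X.param ω) : ℝ) ∂μ with hS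
  have hlm : ∀ {A : Ω → 𝒜}, Measurable A →
      Integrable (fun ω => linearReward φ (X.param ω) (A ω)) μ := fun {A} hA =>
    Integrable.of_bound (measurable_linearReward h.measurable_feature X.measurable_param
      hA).aestronglyMeasurable (c₁ * c₂) (by
        filter_upwards [h.norm_param_ae] with ω hω
        exact abs_linearReward_le h.norm_feature_le hω _)
  have hpt : ∀ t, ∀ᵐ ω ∂μ, linearReward φ (X.param ω) (A' t ω) -
      linearReward φ (X.param ω) (X.action t ω) ≤ 2 * (c₁ * c₂) := fun t => by
    filter_upwards [h.norm_param_ae] with ω hω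
    have h1 := abs_le.1 (abs_linearReward_le h.norm_feature_le hω (A' t ω))
    have h2 := abs_le.1 (abs_linearReward_le h.norm_feature_le hω (X.action t ω))
    linarith
  have hterm : ∀ t, ∫ ω, (linearReward φ (X.param ω) (A' t ω) -
      linearReward φ (X.param ω) (X.action t ω)) ∂μ ≤ 2 * (c₁ * c₂) * min 1 S := fun t => by
    have hi := (hlm (hA'm t)).sub (hlm (X.measurable_action t))
    rw [mul_min_of_nonneg _ _ (by positivity)]
    refine le_min ?_ ?_
    · have := integral_mono_ae hi (integrable_const (2 * (c₁ * c₂))) (hpt t)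
      simpa using this
    · rw [hS, ← integral_const_mul]
      refine integral_mono_ae hi (h0.const_mul _) ?_
      filter_upwards [hpt t] with ω hω
      by_cases hz : X.param ω = 0
      · simp only [linearReward, hz, inner_zero_right, sub_zero]
        positivity
      · refine hω.trans (le_mul_of_one_le_right (by positivity) (one_le_zeroNorm hz))
  calc _ ≤ ∑ _t ∈ Finset.range T, 2 * (c₁ * c₂) * min 1 S := Finset.sum_le_sum fun t _ => hterm t
    _ = _ := by
      simp
      ring

/-- The regret bound in terms of the expected sparsity. -/
theorem IsLinearPosteriorSampling.exists_bayesRegret_le (hσ : 0 < σ) (hc₁ : 0 < c₁)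
    (hc₂ : 0 < c₂) : ∃ C : ℝ, 0 < C ∧
      ∀ (d : ℕ) (Ω : Type*) [MeasurableSpace Ω] (μ : Measure Ω) [IsProbabilityMeasure μ]
        (𝒜 : Type*) [MeasurableSpace 𝒜] (Θ : Set (EuclideanSpace ℝ (Fin d)))
        (φ : 𝒜 → EuclideanSpace ℝ (Fin d)) (X : BanditProcess μ (EuclideanSpace ℝ (Fin d)) 𝒜),
        IsLinearPosteriorSampling σ c₁ c₂ Θ φ X → ∀ T : ℕ, 2 ≤ T →
          X.bayesRegret (linearReward φ) T ≤ C * Real.log T *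
            Real.sqrt ((∫ ω, (zeroNorm (X.param ω) : ℝ) ∂μ) * d * T) := by
  have hl2 : 0 < Real.log 2 := Real.log_pos (by norm_num)
  set η : ℝ := 1 / (4 * σ ^ 2) with hη
  have hη0 : 0 < η := by positivity
  set c : ℝ := η / 2 / (1 + 2 * η * (c₁ * c₂) ^ 2) with hc
  have hc0 : 0 < c := by positivity
  have hlog0 : 0 < Real.log (2 * (c₁ + 2)) := Real.log_pos (by linarith)
  set C₂ : ℝ := (c₂ ^ 2 * c₁ ^ 2 + (1 + η * c₂ ^ 2) / c + Real.log (2 * (c₁ + 2)) / c) / Real.log 2 +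
    4 / c with hC₂
  have hC₂0 : 0 < C₂ := by positivity
  refine ⟨4 + C₂ + 2 * (c₁ * c₂) / Real.log 2, by positivity, ?_⟩
  intro d Ω _ μ _ 𝒜 _ Θ φ X h T hT
  have hT2 : (2 : ℝ) ≤ T := by exact_mod_cast hT
  have hT0 : (0 : ℝ) < T := by linarith
  set S := ∫ ω, (zeroNorm (X.param ω) : ℝ) ∂μ with hS
  have hS0 : 0 ≤ S := integral_nonneg fun ω => Nat.cast_nonneg _
  have hSd : S ≤ d := by
    have := integral_mono (integrable_zeroNorm (μ := μ) X.measurable_param)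
      (integrable_const (d : ℝ)) fun ω => zeroNorm_le (X.param ω)
    simpa using this
  set L := Real.log T with hL
  have hL2 : Real.log 2 ≤ L := Real.log_le_log (by norm_num) hT2
  have hL0 : 0 < L := hl2.trans_le hL2
  set R := Real.sqrt (S * d * T) with hR
  have hR0 : 0 ≤ R := Real.sqrt_nonneg _
  -- Covers the degenerate regimes T ≤ d, d = 0 and S ≤ 1/T. Outside them, log(d + T) is of order
  -- log T, and the error terms of order 1/T are absorbed by S.
  have htriv : T * min 1 S ≤ R → X.bayesRegret (linearReward φ) T ≤
      (4 + C₂ + 2 * (c₁ * c₂) / Real.log 2) * L * R := by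
    intro hle
    refine (h.bayesRegret_le_trivial hc₁ hc₂ T).trans ?_
    calc 2 * (c₁ * c₂) * (T * min 1 S) ≤ 2 * (c₁ * c₂) * R := by gcongr
      _ = 2 * (c₁ * c₂) / Real.log 2 * Real.log 2 * R := by field_simp
      _ ≤ 2 * (c₁ * c₂) / Real.log 2 * L * R := by gcongr
      _ ≤ _ := by
        gcongr
        linarith
  rcases le_total (T : ℝ) d with hdT | hdT
  · refine htriv (Real.le_sqrt_of_sq_le ?_)
    have h1 : (min 1 S) ^ 2 ≤ S := by
      rcases le_total 1 S with h | h
      · rw [min_eq_left h]; linarith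
      · rw [min_eq_right h]; nlinarith
    calc (T * min 1 S) ^ 2 = (min 1 S) ^ 2 * T * T := by ring
      _ ≤ S * d * T := by gcongr
  rcases Nat.eq_zero_or_pos d with hd | hd
  · refine htriv ?_
    have : S = 0 := le_antisymm (hSd.trans_eq (by simp [hd])) hS0
    simp [this, hR0]
  have hd1 : (1 : ℝ) ≤ d := by exact_mod_cast hd
  have hd0 : (0 : ℝ) < d := by linarith
  rcases le_total S (1 / T) with hST | hST
  · refine htriv (Real.le_sqrt_of_sq_le ?_)
    have h1 : T * S ≤ d := by
      rw [le_div_iff₀ hT0] at hST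
      linarith
    have h2 : 0 ≤ min 1 S := le_min zero_le_one hS0
    calc (T * min 1 S) ^ 2 ≤ (T * S) ^ 2 := by gcongr; exact min_le_right _ _
      _ = S * (T * S) * T := by ring
      _ ≤ S * d * T := by gcongr
  obtain ⟨y, hym, hyB, hy⟩ := h.exists_prediction hσ hc₁ hc₂ hd (by exact_mod_cast hdT)
  have hSpos : 0 < S := lt_of_lt_of_le (by positivity) hST
  have hlogT : Real.log (2 * (c₁ + 2) * T ^ 4) = Real.log (2 * (c₁ + 2)) + 4 * L := by
    rw [Real.log_mul (by positivity) (by positivity), Real.log_pow]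
    norm_num [hL]
  have hβ : ∀ t < T, ∫ ω, (c₂ ^ 2 * ‖X.param ω‖ ^ 2 + ∑ k ∈ Finset.range t,
      (linearReward φ (X.param ω) (X.action k ω) - y k ω) ^ 2) ∂μ ≤ C₂ * (S * L) := by
    intro t ht
    have h1 := hy t ht.le
    rw [← hη, ← hc, hlogT, ← hS, ← le_div_iff₀' hc0] at h1
    have hyi : Integrable (fun ω => ∑ k ∈ Finset.range t,
        (linearReward φ (X.param ω) (X.action k ω) - y k ω) ^ 2) μ := by
      refine integrable_finsetSum _ fun k _ => ?_
      have hm1 := measurable_linearReward h.measurable_feature X.measurable_param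
        (X.measurable_action k)
      have hm2 := (hym (k + 1) k (Nat.lt_succ_self k)).mono (X.history_le _) le_rfl
      refine Integrable.of_bound ((hm1.sub hm2).pow_const 2).aestronglyMeasurable
        ((c₁ * c₂ + c₁ * c₂) ^ 2) ?_
      filter_upwards [h.norm_param_ae] with ω hω
      rw [norm_pow, Real.norm_eq_abs]
      exact pow_le_pow_left₀ (abs_nonneg _) ((abs_sub _ _).trans
        (add_le_add (abs_linearReward_le h.norm_feature_le hω _) (hyB k ω))) 2
    have hzi := (integrable_zeroNorm (μ := μ) X.measurable_param).const_mul (c₂ ^ 2 * c₁ ^ 2)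
    -- The regularization term must also scale with `S`; a nonzero parameter has sparsity at least
    -- 1.
    have hni : ∀ᵐ ω ∂μ, c₂ ^ 2 * ‖X.param ω‖ ^ 2 ≤ c₂ ^ 2 * c₁ ^ 2 * zeroNorm (X.param ω) := by
      filter_upwards [h.norm_param_ae] with ω hω
      by_cases hz : X.param ω = 0
      · rw [hz, norm_zero]
        simp only [ne_eq, OfNat.ofNat_ne_zero, not_false_eq_true, zero_pow, mul_zero]
        positivity
      · calc c₂ ^ 2 * ‖X.param ω‖ ^ 2 ≤ c₂ ^ 2 * c₁ ^ 2 := by gcongr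
          _ ≤ _ := le_mul_of_one_le_right (by positivity) (one_le_zeroNorm hz)
    have h2 : ∫ ω, (c₂ ^ 2 * ‖X.param ω‖ ^ 2 + ∑ k ∈ Finset.range t,
        (linearReward φ (X.param ω) (X.action k ω) - y k ω) ^ 2) ∂μ ≤
        c₂ ^ 2 * c₁ ^ 2 * S + ∫ ω, ∑ k ∈ Finset.range t,
          (linearReward φ (X.param ω) (X.action k ω) - y k ω) ^ 2 ∂μ := by
      rw [hS, ← integral_const_mul, ← integral_add hzi hyi]
      refine integral_mono_of_nonneg (Filter.Eventually.of_forall fun ω => ?_) (hzi.add hyi) ?_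
      · exact add_nonneg (by positivity) (Finset.sum_nonneg fun k _ => sq_nonneg _)
      · filter_upwards [hni] with ω hω
        exact add_le_add_left hω _
    have h3 : (1 + η * c₂ ^ 2) / (T : ℝ) ≤ (1 + η * c₂ ^ 2) * S := by
      rw [div_eq_mul_one_div]
      gcongr
    set D := c₂ ^ 2 * c₁ ^ 2 + (1 + η * c₂ ^ 2) / c + Real.log (2 * (c₁ + 2)) / c with hD
    have hD0 : 0 < D := by positivity
    calc _ ≤ c₂ ^ 2 * c₁ ^ 2 * S +
          (S * (Real.log (2 * (c₁ + 2)) + 4 * L) + (1 + η * c₂ ^ 2) * S) / c :=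
          h2.trans (add_le_add_right (h1.trans (by gcongr)) _)
      _ = D / Real.log 2 * (S * Real.log 2) + 4 / c * (S * L) := by
          rw [hD]
          field_simp
          ring
      _ ≤ D / Real.log 2 * (S * L) + 4 / c * (S * L) := by gcongr
      _ = C₂ * (S * L) := by rw [hC₂]; ring
  -- Makes `α * d` and `α⁻¹ * (T * S)` both equal to `R`.
  set α := Real.sqrt (S * T / d) with hα
  have hα0 : 0 < α := Real.sqrt_pos.2 (by positivity)
  have hmain := h.bayesRegret_le_of_prediction hc₂ hym hyB hα0 (by omega) hβ
  have hαd : α * d = R := by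
    rw [hα, hR, show S * d * T = S * T / d * d ^ 2 by field_simp, Real.sqrt_mul (by positivity),
      Real.sqrt_sq hd0.le]
  have hαT : α⁻¹ * (T * S) = R := by
    have h1 : α * α = S * T / d := Real.mul_self_sqrt (by positivity)
    rw [← hαd, inv_mul_eq_iff_eq_mul₀ hα0.ne', ← mul_assoc, h1]
    field_simp
  -- Here d + T ≤ 2T ≤ T².
  have hlogdT : Real.log (d + T) ≤ 2 * L := by
    rw [hL, ← Real.log_rpow hT0]
    refine Real.log_le_log (by positivity) ?_
    norm_num
    nlinarith
  calc _ ≤ α * (2 * d * (2 * L)) + α⁻¹ * (T * (C₂ * (S * L))) := by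
        refine hmain.trans ?_
        gcongr
    _ = 4 * L * (α * d) + C₂ * L * (α⁻¹ * (T * S)) := by ring
    _ = (4 + C₂) * L * R := by rw [hαd, hαT]; ring
    _ ≤ _ := by
      have : 0 < 2 * (c₁ * c₂) / Real.log 2 := by positivity
      exact mul_le_mul_of_nonneg_right (mul_le_mul_of_nonneg_right (by linarith) hL0.le) hR0

end Regret

/-! ### From the expected sparsity to the expected square root -/

theorem mainTheorem9 :
    ∃ k : ℕ, ∀ σ c₁ c₂ : ℝ, 0 < σ → 0 < c₁ → 0 < c₂ → ∃ C : ℝ, 0 < C ∧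
      ∀ (d : ℕ) (Ω : Type*) [MeasurableSpace Ω] (μ : MeasureTheory.Measure Ω)
        [MeasureTheory.IsProbabilityMeasure μ] (𝒜 : Type*) [MeasurableSpace 𝒜]
        (Θ : Set (EuclideanSpace ℝ (Fin d))) (φ : 𝒜 → EuclideanSpace ℝ (Fin d))
        (X : BanditProcess μ (EuclideanSpace ℝ (Fin d)) 𝒜),
        IsLinearPosteriorSampling σ c₁ c₂ Θ φ X →
          -- the bound `O(d log T √T)`
          (∀ T : ℕ, 2 ≤ T →
            X.bayesRegret (linearReward φ) T ≤ C * (d * Real.log T * Real.sqrt T)) ∧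
          -- the bound `Õ(E √(‖θ‖₀ d T))` as `T → ∞`, with constants independent of the problem
          (∀ᶠ T : ℕ in Filter.atTop,
            X.bayesRegret (linearReward φ) T ≤
              C * Real.log T ^ k * ∫ ω, Real.sqrt (zeroNorm (X.param ω) * d * T) ∂μ) ∧
          -- the same bound for every `T ≥ 2`, the constant depending on the prior only through
          -- the ratio of `√(E ‖θ‖₀)` to `E √‖θ‖₀`
          (∀ κ : ℝ,
            Real.sqrt (∫ ω, (zeroNorm (X.param ω) : ℝ) ∂μ) ≤
                κ * ∫ ω, Real.sqrt (zeroNorm (X.param ω)) ∂μ →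
              ∀ T : ℕ, 2 ≤ T →
                X.bayesRegret (linearReward φ) T ≤
                  C * κ * Real.log T ^ k *
                    ∫ ω, Real.sqrt (zeroNorm (X.param ω) * d * T) ∂μ) := by
  -- One logarithm comes from the regret bound; the second absorbs the ratio of `√S` to `E` for
  -- large `T`.
  refine ⟨2, fun σ c₁ c₂ hσ hc₁ hc₂ => ?_⟩
  obtain ⟨C, hC, hbound⟩ := IsLinearPosteriorSampling.exists_bayesRegret_le hσ hc₁ hc₂
  have hl2 : 0 < Real.log 2 := Real.log_pos (by norm_num)
  have hl2' : Real.log 2 ≤ 1 := by linarith [Real.log_two_lt_d9]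
  have hCC : C ≤ C / Real.log 2 := by
    rw [le_div_iff₀ hl2]
    nlinarith
  -- Dividing by log 2 ≤ log T pays for the superfluous logarithm in the last claim.
  refine ⟨C / Real.log 2, by positivity, fun d Ω _ μ _ 𝒜 _ Θ φ X h => ?_⟩
  have hmain := hbound d Ω μ 𝒜 Θ φ X h
  set S := ∫ ω, (zeroNorm (X.param ω) : ℝ) ∂μ with hS
  set E := ∫ ω, Real.sqrt (zeroNorm (X.param ω)) ∂μ with hE
  have hS0 : 0 ≤ S := integral_nonneg fun ω => Nat.cast_nonneg _
  have hE0 : 0 ≤ E := integral_nonneg fun ω => Real.sqrt_nonneg _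
  have hzi := integrable_zeroNorm (μ := μ) X.measurable_param
  have hSd : S ≤ d := by
    have := integral_mono hzi (integrable_const (d : ℝ)) fun ω => zeroNorm_le (X.param ω)
    simpa using this
  have hsi : Integrable (fun ω => Real.sqrt (zeroNorm (X.param ω))) μ :=
    Integrable.of_bound (measurable_zeroNorm.comp X.measurable_param).sqrt.aestronglyMeasurable
      (Real.sqrt d) (Filter.Eventually.of_forall fun ω => by
        rw [Real.norm_eq_abs, abs_of_nonneg (Real.sqrt_nonneg _)]
        exact Real.sqrt_le_sqrt (zeroNorm_le _))
  -- Needed only to see that `E = 0` forces `S = 0`, when the ratio `√S / E` is meaningless.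
  have hSE : S ≤ Real.sqrt d * E := by
    rw [hS, hE, ← integral_const_mul]
    refine integral_mono hzi (hsi.const_mul _) fun ω => ?_
    calc (zeroNorm (X.param ω) : ℝ)
        = Real.sqrt (zeroNorm (X.param ω)) * Real.sqrt (zeroNorm (X.param ω)) :=
          (Real.mul_self_sqrt (Nat.cast_nonneg _)).symm
      _ ≤ Real.sqrt d * Real.sqrt (zeroNorm (X.param ω)) :=
          mul_le_mul_of_nonneg_right (Real.sqrt_le_sqrt (zeroNorm_le _)) (Real.sqrt_nonneg _)
  have hint : ∀ T : ℕ, ∫ ω, Real.sqrt (zeroNorm (X.param ω) * d * T) ∂μ =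
      E * Real.sqrt (d * T) := fun T => by
    rw [hE, ← integral_mul_const]
    refine integral_congr_ae (Filter.Eventually.of_forall fun ω => ?_)
    dsimp only
    rw [mul_assoc, Real.sqrt_mul (Nat.cast_nonneg _)]
  have hsplit : ∀ T : ℕ, Real.sqrt (S * d * T) = Real.sqrt S * Real.sqrt (d * T) := fun T => by
    rw [mul_assoc, Real.sqrt_mul hS0]
  refine ⟨fun T hT => ?_, ?_, fun κ hκ T hT => ?_⟩
  · have hL0 : 0 ≤ Real.log T := Real.log_natCast_nonneg T
    have h1 : Real.sqrt (S * d * T) ≤ d * Real.sqrt T := by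
      rw [show (d : ℝ) * Real.sqrt T = Real.sqrt (d * d * T) by
        rw [Real.sqrt_mul (by positivity), Real.sqrt_mul_self (Nat.cast_nonneg d)]]
      exact Real.sqrt_le_sqrt (by gcongr)
    calc _ ≤ C * Real.log T * Real.sqrt (S * d * T) := hmain T hT
      _ ≤ C / Real.log 2 * Real.log T * (d * Real.sqrt T) := by gcongr
      _ = _ := by ring
  · have hlog : Filter.Tendsto (fun T : ℕ => Real.log T) Filter.atTop Filter.atTop :=
      Real.tendsto_log_atTop.comp tendsto_natCast_atTop_atTop
    filter_upwards [Filter.eventually_ge_atTop 2, hlog.eventually_ge_atTop (Real.sqrt S / E)]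
      with T hT hTE
    have hL0 : 0 ≤ Real.log T := Real.log_natCast_nonneg T
    have h1 : Real.sqrt S ≤ Real.log T * E := by
      rcases hE0.eq_or_lt with hE' | hE'
      · rw [← hE', mul_zero] at hSE
        rw [Real.sqrt_eq_zero_of_nonpos hSE]
        positivity
      · rwa [div_le_iff₀ hE'] at hTE
    rw [hint]
    calc _ ≤ C * Real.log T * Real.sqrt (S * d * T) := hmain T hT
      _ = C * Real.log T * (Real.sqrt S * Real.sqrt (d * T)) := by rw [hsplit]
      _ ≤ C / Real.log 2 * Real.log T * ((Real.log T * E) * Real.sqrt (d * T)) := by gcongr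
      _ = _ := by ring
  · have hL2 : Real.log 2 ≤ Real.log T := Real.log_le_log (by norm_num) (by exact_mod_cast hT)
    have hL0 : 0 ≤ Real.log T := hl2.le.trans hL2
    have hκE : 0 ≤ κ * E := (Real.sqrt_nonneg _).trans hκ
    rw [hint]
    calc _ ≤ C * Real.log T * Real.sqrt (S * d * T) := hmain T hT
      _ = C / Real.log 2 * Real.log 2 * Real.log T * (Real.sqrt S * Real.sqrt (d * T)) := by
        rw [hsplit]
        field_simp
      _ ≤ C / Real.log 2 * Real.log T * Real.log T * ((κ * E) * Real.sqrt (d * T)) := by gcongr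
      _ = _ := by ring
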